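/- **Partial recovery from a regularized adjacency matrix.** For every $\varepsilon>0$ and $r\ge 1$ there is a constant $C>0$, depending only on $\varepsilon$ and $r$, such that the following holds. Let $n$ be a natural number and $0\le b<a\le n$ real numbers with $$(a-b)^2 > C(a+b).$$ Let the vertex set $\{1,\dots,n\}$ be split into two communities of $n/2$ vertices each, and let $A$ be the adjacency matrix of a random simple graph drawn from the stochastic block model $G(n,\frac an,\frac bn)$: distinct vertices are joined independently, with probability $a/n$ if they lie in the same community and $b/n$ if they lie in different communities. Then with probability at least $1-e^{-r}$ the following holds for every symmetric matrix $A'$ that arises from $A$ by reducing, in an arbitrary way (keeping them nonnegative), the weights of the edges incident to vertices of degree larger than $2a$ so that all degrees (row sums) of the new weighted graph are at most $2a$, all other edges keeping their weights. Let $\lambda_1\ge\lambda_2\ge\dots\ge\lambda_n$ be the eigenvalues of $A'$, and let $v_2$ be any eigenvector of $A'$ for the second largest eigenvalue $\lambda_2$ (in the degenerate case $\lambda_1=\lambda_2$, any such eigenvector orthogonal to some nonzero entrywise nonnegative eigenvector for $\lambda_1$). Then the signs of the entries of $v_2$ correctly estimate the partition into the two communities, up to at most $\varepsilon n$ misclassified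 vertices: one can assign to the two communities two distinct signs from $\{+,0,-\}$ such that all but at most $\varepsilon n$ vertices $i$ are such that $v_2(i)$ has the sign assigned to the community of $i$. -/

import Mathlib

open MeasureTheory ProbabilityTheory

/-- `c` splits the vertex set into two communities of equal size. -/
def IsBalanced {n : ℕ} (c : Fin n → Bool) : Prop :=
  {i | c i = true}.ncard = {i | c i = false}.ncard

/-- `G` is a random simple graph (no loops) on `Fin n` with independent edges, defined on the
probability space `(Ω, μ)`: two distinct vertices are joined with probability `p` if they lie in
the same community of `c`, and with probability `q` otherwise. -/
structure IsPlantedPartitionGraph {Ω : Type*} [MeasurableSpace Ω] (μ : Measure Ω) {n : ℕ}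
    (c : Fin n → Bool) (p q : ℝ) (G : Ω → SimpleGraph (Fin n)) : Prop where
  measurableSet_adj : ∀ i j, MeasurableSet {ω | (G ω).Adj i j}
  prob_adj : ∀ i j, i ≠ j →
    μ {ω | (G ω).Adj i j} = ENNReal.ofReal (if c i = c j then p else q)
  indep : iIndepSet
    (fun e : {e : Fin n × Fin n // e.1 < e.2} => {ω | (G ω).Adj e.1.1 e.1.2}) μ

open Classical in
/-- The 0-1 adjacency matrix of `G`. -/
noncomputable def adjacency {n : ℕ} (G : SimpleGraph (Fin n)) : Matrix (Fin n) (Fin n) ℝ :=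
  G.adjMatrix ℝ

/-- The degree of the vertex `i` in the weighted graph with adjacency matrix `M`. -/
def weightedDegree {n : ℕ} (M : Matrix (Fin n) (Fin n) ℝ) (i : Fin n) : ℝ :=
  ∑ j, M i j

/-- `A'` arises from `A` by reducing in some way (keeping them nonnegative and the matrix
symmetric) the weights of the edges incident to vertices of degree larger than `t`, so that all
degrees of the new weighted graph are at most `t`. Edges between two vertices of degree
at most `t` keep their weights. -/
structure IsDegreeRegularization {n : ℕ} (A : Matrix (Fin n) (Fin n) ℝ) (t : ℝ)
    (A' : Matrix (Fin n) (Fin n) ℝ) : Prop where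
  symm : A'.IsSymm
  nonneg : ∀ i j, 0 ≤ A' i j
  le : ∀ i j, A' i j ≤ A i j
  eq_of_degree_le : ∀ i j, weightedDegree A i ≤ t → weightedDegree A j ≤ t → A' i j = A i j
  degree_le : ∀ i, weightedDegree A' i ≤ t

/-- `v` is an eigenvector of the symmetric matrix `M` for its second largest eigenvalue `λ₂`,
where `λ₁ ≥ λ₂ ≥ ⋯` are the eigenvalues of `M` counted with multiplicity.
Only in the degenerate case `λ₁ = λ₂`, where the eigenspace of `λ₂` contains that of the largest
eigenvalue, it is moreover required that `v` is orthogonal to a leading eigenvector with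
nonnegative entries. If `λ₁ > λ₂`, then `v` is any eigenvector for `λ₂`. -/
def IsSecondEigenvector {n : ℕ} (M : Matrix (Fin n) (Fin n) ℝ) (v : Fin n → ℝ) : Prop :=
  ∃ (hM : M.IsHermitian) (k₁ k₂ : Fin (Fintype.card (Fin n))),
    (k₁ : ℕ) = 0 ∧ (k₂ : ℕ) = 1 ∧
    v ≠ 0 ∧ M.mulVec v = hM.eigenvalues₀ k₂ • v ∧
    (hM.eigenvalues₀ k₁ = hM.eigenvalues₀ k₂ →
      ∃ u : Fin n → ℝ, u ≠ 0 ∧ (∀ i, 0 ≤ u i) ∧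
        M.mulVec u = hM.eigenvalues₀ k₁ • u ∧ dotProduct u v = 0)

/-- The signs of the entries of `v` determine the communities of `c`, up to a permutation of the
two labels and up to at most `m` misclassified vertices: there are two distinct signs, one for each
community, and all but at most `m` vertices `i` are such that `v i` has the sign of the community
of `i`. -/
def SignsRecover {n : ℕ} (c : Fin n → Bool) (v : Fin n → ℝ) (m : ℝ) : Prop :=
  ∃ α β : SignType, α ≠ β ∧
    ({i | SignType.sign (v i) ≠ if c i = true then α else β}.ncard : ℝ) ≤ m

/-! Write M for the block matrix with entries a/n inside and b/n across communities, diagonal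
included. The probabilistic half shows, in the manner of Kahn and Szemerédi, that every
regularization `A'` is within O(√a) of M in operator norm. By `norm_toEuclideanCLM_le_of_int` it
suffices to control the quadratic form at the integer vectors z of norm at most 4√n, of which there
are only exponentially many. Pairs with |z_i z_j| ≤ 2√a are handled for the unregularized `A` by a
Chernoff and union bound (`measure_not_hasLightBound_le`); passing to `A'` is cheap there, since
degrees above 2a are rare and the removed weight is O(n). The remaining pairs are summed over dyadic
levels of |z_i| (`HasDiscrepancy.sum_heavy_le`): far apart levels use the degree bound of `A'`, the
others a discrepancy property of `A`. The random events concern `A` alone, so one event serves all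
`A'` at once.

The spectral half is deterministic. M has eigenvalues (a+b)/2 and (a-b)/2 on the span of the two
community indicators and 0 on its complement. The assumption on a and b makes the error β a small
multiple of ε(a-b); hence λ₂ is at least (a-b)/2 - β and v₂ is close to the span. Perturbation
theory does not tell which vector of the span it approximates, because the two eigenvalues differ
only by b, possibly less than β. The missing information is a nonnegative leading eigenvector u
orthogonal to v₂. If both community coefficients of v₂ are bounded away from 0, orthogonality forces
opposite signs. If one is small, u concentrates on that community, so b = O(β) and the communities
almost decouple (`signsRecover_of_small_coeff`). With v₂ normalized to have nonnegative coefficient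
on the other community, testing its equation against its negative parts leaves two options: v₂ is
negative on most of the community, or v₂ ≥ 0 everywhere and so vanishes wherever u > 0, that is, on
most of the community. The second option is why the sign 0 has to be admitted. -/

/-! ### Exponential moments of the centred adjacency matrix. -/

/-- The matrix of edge probabilities of the planted partition model. -/
def edgeProbability {n : ℕ} (c : Fin n → Bool) (p q : ℝ) : Matrix (Fin n) (Fin n) ℝ :=
  fun i j => if i = j then 0 else if c i = c j then p else q

theorem edgeProbability_symm {n : ℕ} (c : Fin n → Bool) (p q : ℝ) (i j : Fin n) :
    edgeProbability c p q i j = edgeProbability c p q j i := by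
  simp only [edgeProbability, eq_comm]

theorem edgeProbability_self {n : ℕ} (c : Fin n → Bool) (p q : ℝ) (i : Fin n) :
    edgeProbability c p q i i = 0 := by
  simp [edgeProbability]

theorem edgeProbability_nonneg {n : ℕ} {c : Fin n → Bool} {p q : ℝ} (hp : 0 ≤ p) (hq : 0 ≤ q)
    (i j : Fin n) : 0 ≤ edgeProbability c p q i j := by
  unfold edgeProbability
  split_ifs <;> simp [*]

theorem edgeProbability_le {n : ℕ} {c : Fin n → Bool} {p q : ℝ} (hq : 0 ≤ q) (hqp : q ≤ p)
    (i j : Fin n) : edgeProbability c p q i j ≤ p := by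
  unfold edgeProbability
  split_ifs <;> linarith

theorem adjacency_symm {n : ℕ} (H : SimpleGraph (Fin n)) (i j : Fin n) :
    adjacency H i j = adjacency H j i := by
  by_cases h : H.Adj i j
  · simp [adjacency, SimpleGraph.adjMatrix_apply, h, h.symm]
  · have h' : ¬ H.Adj j i := fun h' => h h'.symm
    simp [adjacency, SimpleGraph.adjMatrix_apply, h, h']

theorem adjacency_self {n : ℕ} (H : SimpleGraph (Fin n)) (i : Fin n) :
    adjacency H i i = 0 := by
  simp [adjacency, SimpleGraph.adjMatrix_apply]

theorem adjacency_nonneg {n : ℕ} (H : SimpleGraph (Fin n)) (i j : Fin n) :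
    0 ≤ adjacency H i j := by
  simp only [adjacency, SimpleGraph.adjMatrix_apply]
  split_ifs <;> norm_num

/-- A sum over ordered pairs that vanishes on the diagonal, as a sum over pairs `i < j`. -/
theorem sum_sum_eq_sum_lt {n : ℕ} (f : Fin n → Fin n → ℝ) (hf : ∀ i, f i i = 0) :
    ∑ i, ∑ j, f i j =
      ∑ e : {e : Fin n × Fin n // e.1 < e.2}, (f e.1.1 e.1.2 + f e.1.2 e.1.1) := by
  classical
  rw [← Finset.sum_product', Finset.univ_product_univ,
    ← Finset.sum_subtype (Finset.univ.filter fun e : Fin n × Fin n => e.1 < e.2) (by simp)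
      (fun e => f e.1 e.2 + f e.2 e.1), Finset.sum_add_distrib]
  have h1 : ∑ e ∈ Finset.univ.filter (fun e : Fin n × Fin n => e.1 < e.2), f e.2 e.1
      = ∑ e ∈ Finset.univ.filter (fun e : Fin n × Fin n => e.2 < e.1), f e.1 e.2 := by
    refine Finset.sum_nbij' Prod.swap Prod.swap ?_ ?_ ?_ ?_ ?_ <;> simp
  rw [h1, Finset.sum_filter, Finset.sum_filter, ← Finset.sum_add_distrib]
  refine Finset.sum_congr rfl fun e _ => ?_
  rcases lt_trichotomy e.1 e.2 with h | h | h
  · simp [h, h.le]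
  · have : e = (e.1, e.1) := Prod.ext rfl h.symm
    rw [this]; simp [hf]
  · simp [h, h.le]

section

variable {Ω : Type*} [MeasurableSpace Ω] {μ : Measure Ω} [IsProbabilityMeasure μ] {n : ℕ}
  {c : Fin n → Bool} {p q : ℝ} {G : Ω → SimpleGraph (Fin n)}

omit [MeasurableSpace Ω] in
theorem adjacency_eq_indicator (G : Ω → SimpleGraph (Fin n)) (i j : Fin n) (ω : Ω) :
    adjacency (G ω) i j = Set.indicator {ω | (G ω).Adj i j} (fun _ => (1 : ℝ)) ω := by
  by_cases h : (G ω).Adj i j <;> simp [adjacency, SimpleGraph.adjMatrix_apply, h]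

omit [IsProbabilityMeasure μ] in
theorem IsPlantedPartitionGraph.measurable_adjacency
    (hG : IsPlantedPartitionGraph μ c p q G) (i j : Fin n) :
    Measurable fun ω => adjacency (G ω) i j := by
  simp only [adjacency_eq_indicator]
  exact measurable_const.indicator (hG.measurableSet_adj i j)

theorem IsPlantedPartitionGraph.mgf_adjacency (hG : IsPlantedPartitionGraph μ c p q G)
    (hp : 0 ≤ p) (hq : 0 ≤ q) {i j : Fin n} (hij : i ≠ j) (w : ℝ) :
    mgf (fun ω => w * adjacency (G ω) i j) μ 1
      = 1 + edgeProbability c p q i j * (Real.exp w - 1) := by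
  have h1 : ∀ ω, Real.exp (1 * (w * adjacency (G ω) i j))
      = 1 + Set.indicator {ω | (G ω).Adj i j} (fun _ => Real.exp w - 1) ω := by
    intro ω
    rw [adjacency_eq_indicator]
    by_cases h : (G ω).Adj i j <;> simp [h]
  have hm := hG.measurableSet_adj i j
  rw [mgf]
  simp only [h1]
  rw [integral_add (integrable_const _) ((integrable_const _).indicator hm),
    integral_indicator_const _ hm]
  have : μ.real {ω | (G ω).Adj i j} = edgeProbability c p q i j := by
    rw [measureReal_def, hG.prob_adj i j hij, ENNReal.toReal_ofReal]
    · simp [edgeProbability, hij]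
    · split_ifs <;> assumption
  simp [this]

/-- Convexity of e^x - 1 - x at the midpoint of 2x and 2y. The entries (i,j) and (j,i) are one
random variable carrying the weight w i j + w j i; this splits its exponential moment into a sum
over ordered pairs, at the price of doubled weights. -/
theorem exp_add_sub_le (x y : ℝ) :
    Real.exp (x + y) - 1 - (x + y) ≤
      (Real.exp (2 * x) - 1 - 2 * x) / 2 + (Real.exp (2 * y) - 1 - 2 * y) / 2 := by
  have h1 : Real.exp (x + y) = Real.exp x * Real.exp y := Real.exp_add x y
  have h2 : Real.exp (2 * x) = Real.exp x ^ 2 := by rw [← Real.exp_nat_mul]; norm_num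
  have h3 : Real.exp (2 * y) = Real.exp y ^ 2 := by rw [← Real.exp_nat_mul]; norm_num
  rw [h1, h2, h3]
  nlinarith [sq_nonneg (Real.exp x - Real.exp y)]

/-- The moment factors over the independent edges i < j. Each Bernoulli factor 1 + P(e^x - 1) is at
most exp(P(e^x - 1)), and centring turns the exponent into P(e^x - 1 - x). -/
theorem IsPlantedPartitionGraph.integral_exp_sum_le (hG : IsPlantedPartitionGraph μ c p q G)
    (hp : 0 ≤ p) (hq : 0 ≤ q) (w : Fin n → Fin n → ℝ) :
    mgf (fun ω => ∑ i, ∑ j, w i j * (adjacency (G ω) i j - edgeProbability c p q i j)) μ 1 ≤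
      Real.exp (∑ i, ∑ j, edgeProbability c p q i j *
        ((Real.exp (2 * w i j) - 1 - 2 * w i j) / 2)) := by
  set P := edgeProbability c p q with hP
  let E := {e : Fin n × Fin n // e.1 < e.2}
  let X : E → Ω → ℝ := fun e ω => (w e.1.1 e.1.2 + w e.1.2 e.1.1) * adjacency (G ω) e.1.1 e.1.2
  have hX : iIndepFun X μ := by
    have h := hG.indep.iIndepFun_indicator (β := ℝ) (m := inferInstance)
    have h2 := h.comp (fun e x => (w e.1.1 e.1.2 + w e.1.2 e.1.1) * x)
      (fun e => measurable_const.mul measurable_id)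
    convert h2 using 1
    ext e ω
    simp only [X, adjacency_eq_indicator]
    rfl
  have hXm : ∀ e, Measurable (X e) := fun e =>
    measurable_const.mul (hG.measurable_adjacency _ _)
  let K : ℝ := ∑ e : E, (w e.1.1 e.1.2 + w e.1.2 e.1.1) * P e.1.1 e.1.2
  have hF : (fun ω => ∑ i, ∑ j, w i j * (adjacency (G ω) i j - P i j))
      = fun ω => (∑ e, X e) ω + (-K) := by
    ext ω
    rw [sum_sum_eq_sum_lt _ (by simp [adjacency_self, hP, edgeProbability_self])]
    simp only [Finset.sum_apply, X, K, ← sub_eq_add_neg]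
    rw [← Finset.sum_sub_distrib]
    refine Finset.sum_congr rfl fun e _ => ?_
    rw [adjacency_symm _ e.1.2 e.1.1, hP, edgeProbability_symm _ _ _ e.1.2 e.1.1]
    ring
  rw [hF, mgf_add_const, hX.mgf_sum hXm]
  simp only [X]
  have hmg : ∀ e : E, mgf (fun ω => (w e.1.1 e.1.2 + w e.1.2 e.1.1) *
      adjacency (G ω) e.1.1 e.1.2) μ 1 ≤
      Real.exp (P e.1.1 e.1.2 * (Real.exp (w e.1.1 e.1.2 + w e.1.2 e.1.1) - 1)) := by
    intro e
    rw [hG.mgf_adjacency hp hq e.2.ne]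
    linarith [Real.add_one_le_exp
      (P e.1.1 e.1.2 * (Real.exp (w e.1.1 e.1.2 + w e.1.2 e.1.1) - 1))]
  refine (mul_le_mul_of_nonneg_right (Finset.prod_le_prod (fun e _ => mgf_nonneg)
    (fun e _ => hmg e)) (Real.exp_pos _).le).trans ?_
  rw [← Real.exp_sum, ← Real.exp_add]
  apply Real.exp_le_exp.2
  rw [sum_sum_eq_sum_lt _ (by simp [hP, edgeProbability_self])]
  simp only [K, one_mul, ← sub_eq_add_neg]
  rw [← Finset.sum_sub_distrib]
  refine Finset.sum_le_sum fun e _ => ?_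
  have h1 := exp_add_sub_le (w e.1.1 e.1.2) (w e.1.2 e.1.1)
  have h2 : 0 ≤ P e.1.1 e.1.2 := edgeProbability_nonneg hp hq _ _
  have h3 : P e.1.2 e.1.1 = P e.1.1 e.1.2 := edgeProbability_symm _ _ _ _ _
  rw [h3]
  nlinarith [mul_le_mul_of_nonneg_left h1 h2]

theorem integrable_exp_of_finite_range {F : Ω → ℝ} (hF : Measurable F)
    {B : ℝ} (hB : ∀ ω, F ω ≤ B) : Integrable (fun ω => Real.exp (1 * F ω)) μ := by
  refine Integrable.of_bound (C := Real.exp B) (by fun_prop) (ae_of_all _ fun ω => ?_)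
  rw [Real.norm_eq_abs, abs_of_pos (Real.exp_pos _), one_mul]
  exact Real.exp_le_exp.2 (hB ω)

theorem abs_adjacency_le_one (H : SimpleGraph (Fin n)) (i j : Fin n) :
    |adjacency H i j| ≤ 1 := by
  simp only [adjacency, SimpleGraph.adjMatrix_apply]
  split_ifs <;> norm_num

theorem IsPlantedPartitionGraph.integrable_exp_sum (hG : IsPlantedPartitionGraph μ c p q G)
    (w : Fin n → Fin n → ℝ) (P : Matrix (Fin n) (Fin n) ℝ) :
    Integrable (fun ω => Real.exp (1 * ∑ i, ∑ j, w i j * (adjacency (G ω) i j - P i j))) μ := by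
  refine integrable_exp_of_finite_range (B := ∑ i, ∑ j, |w i j| * (1 + |P i j|)) ?_ fun ω => ?_
  · exact Finset.measurable_fun_sum _ fun i _ => Finset.measurable_fun_sum _ fun j _ =>
      measurable_const.mul ((hG.measurable_adjacency i j).sub measurable_const)
  · refine Finset.sum_le_sum fun i _ => Finset.sum_le_sum fun j _ => ?_
    refine (le_abs_self _).trans ?_
    rw [abs_mul]
    gcongr
    exact (abs_sub _ _).trans (by gcongr; exact abs_adjacency_le_one _ _ _)

/-- Chernoff bound for weighted sums of the centred adjacency matrix. -/
theorem IsPlantedPartitionGraph.chernoff (hG : IsPlantedPartitionGraph μ c p q G)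
    (hp : 0 ≤ p) (hq : 0 ≤ q) (w : Fin n → Fin n → ℝ) (t : ℝ) :
    μ {ω | t ≤ ∑ i, ∑ j, w i j * (adjacency (G ω) i j - edgeProbability c p q i j)} ≤
      ENNReal.ofReal (Real.exp ((∑ i, ∑ j, edgeProbability c p q i j *
        ((Real.exp (2 * w i j) - 1 - 2 * w i j) / 2)) - t)) := by
  have h := measure_ge_le_exp_mul_mgf (μ := μ) t zero_le_one
    (hG.integrable_exp_sum w (edgeProbability c p q))
  rw [← ENNReal.ofReal_toReal (measure_ne_top μ _)]
  apply ENNReal.ofReal_le_ofReal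
  refine h.trans ?_
  refine (mul_le_mul_of_nonneg_left (hG.integral_exp_sum_le hp hq w)
    (Real.exp_pos _).le).trans ?_
  rw [← Real.exp_add]
  apply Real.exp_le_exp.2
  linarith

end

/-! ### The three random events and their probabilities. -/

/-- The quadratic forms of `A - P` at integer vectors, restricted to the pairs of vertices with a
small product of coordinates, are small. -/
def HasLightBound {n : ℕ} (A P : Matrix (Fin n) (Fin n) ℝ) (a ρ : ℝ) : Prop :=
  ∀ z : Fin n → ℤ, ∑ i, (z i : ℝ) ^ 2 ≤ 16 * n →
    |∑ i, ∑ j, (if |(z i : ℝ) * z j| ≤ 2 * √a then (z i : ℝ) * z j else 0) * (A i j - P i j)| ≤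
      4 * (60 + ρ) * n * √a

/-- A discrepancy property: no two vertex sets have far too many edges between them. -/
def HasDiscrepancy {n : ℕ} (A : Matrix (Fin n) (Fin n) ℝ) (a ρ : ℝ) (L : ℕ) : Prop :=
  ∀ s t k : ℕ, s ≤ n + 2 → t ≤ n + 2 → s + t = L + k →
    ∀ S T : Finset (Fin n), S.Nonempty → T.Nonempty →
      (k + 1) * (Real.log 2 / 2) * ∑ i ∈ S, ∑ j ∈ T, A i j ≤
        a / n * S.card * T.card * 2 ^ k + S.card * (ρ + 4 * s) + T.card * (ρ + 4 * t)
          + n * (1 / 8) ^ s + n * (1 / 8) ^ t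

/-- Few vertices have a large degree. -/
def HasDegreeTail {n : ℕ} (A : Matrix (Fin n) (Fin n) ℝ) (a ρ : ℝ) : Prop :=
  ∑ i, Real.exp (weightedDegree A i / 2 - 9 / 10 * a) ≤ n * Real.exp ρ

theorem sum_exp_neg_sq_le (N : ℕ) :
    ∑ k ∈ Finset.Icc (-(N : ℤ)) N, Real.exp (-(k : ℝ) ^ 2) ≤ 4 := by
  have h1 : ∀ m : ℕ, Real.exp (-(m : ℝ) ^ 2) ≤ (1 / 2) ^ m := by
    intro m
    have : ((1 : ℝ) / 2) ^ m = Real.exp (-(m * Real.log 2)) := by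
      rw [Real.exp_neg, mul_comm, Real.exp_mul, Real.exp_log (by norm_num)]
      simp
    rw [this]
    apply Real.exp_le_exp.2
    have h2 := Real.log_two_lt_d9
    have h3 : (m : ℝ) ≤ (m : ℝ) ^ 2 := by
      exact_mod_cast Nat.le_self_pow two_ne_zero m
    have h4 : (0 : ℝ) ≤ m := m.cast_nonneg
    nlinarith
  have hsub : Finset.Icc (-(N : ℤ)) N ⊆ (Finset.range (N + 1)).image (fun m : ℕ => (m : ℤ)) ∪
      (Finset.range (N + 1)).image (fun m : ℕ => -(m : ℤ)) := by
    intro k hk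
    simp only [Finset.mem_Icc] at hk
    simp only [Finset.mem_union, Finset.mem_image, Finset.mem_range]
    rcases le_total 0 k with h | h
    · left; exact ⟨k.toNat, by omega, by omega⟩
    · right; exact ⟨(-k).toNat, by omega, by omega⟩
  have h5 : ∑ m ∈ Finset.range (N + 1), Real.exp (-(m : ℝ) ^ 2) ≤ 2 :=
    (Finset.sum_le_sum fun m _ => h1 m).trans (sum_geometric_two_le _)
  calc _ ≤ _ := Finset.sum_le_sum_of_subset_of_nonneg hsub fun _ _ _ => (Real.exp_pos _).le
    _ ≤ _ := Finset.sum_union_inter (f := fun k : ℤ => Real.exp (-(k : ℝ) ^ 2)) ▸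
      le_add_of_nonneg_right (Finset.sum_nonneg fun _ _ => (Real.exp_pos _).le)
    _ ≤ 2 + 2 := by
      rw [Finset.sum_image (by simp), Finset.sum_image (by simp)]
      simpa using add_le_add h5 h5
    _ = 4 := by norm_num

/-- Integer vectors with sum of squares at most `16 * n`. -/
noncomputable def latticeBall (n : ℕ) : Finset (Fin n → ℤ) :=
  (Fintype.piFinset fun _ : Fin n => Finset.Icc (-((4 * n : ℕ) : ℤ)) ((4 * n : ℕ) : ℤ)).filter
    fun z => ∑ i, (z i : ℝ) ^ 2 ≤ 16 * n

theorem mem_latticeBall {n : ℕ} {z : Fin n → ℤ} :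
    z ∈ latticeBall n ↔ ∑ i, (z i : ℝ) ^ 2 ≤ 16 * n := by
  simp only [latticeBall, Finset.mem_filter, Fintype.mem_piFinset, Finset.mem_Icc,
    and_iff_right_iff_imp]
  intro h i
  have h1 : (z i : ℝ) ^ 2 ≤ 16 * n :=
    (Finset.single_le_sum (f := fun i => (z i : ℝ) ^ 2) (fun _ _ => sq_nonneg _)
      (Finset.mem_univ i)).trans h
  have h2 : (z i) ^ 2 ≤ 16 * (n : ℤ) := by exact_mod_cast h1
  have h3 : (n : ℤ) ≤ (n : ℤ) ^ 2 := by exact_mod_cast Nat.le_self_pow two_ne_zero n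
  push_cast
  exact abs_le.1 (abs_le_of_sq_le_sq (by nlinarith) (by positivity))

/-- Each point of the ball is charged e^(16n) times the Gaussian weight ∏ exp(-z_i²) ≥ e^(-16n). The
total weight of the surrounding box factors into n one-dimensional sums, each at most 4 ≤ e². -/
theorem card_latticeBall_le (n : ℕ) : ((latticeBall n).card : ℝ) ≤ Real.exp (18 * n) := by
  have h4 : (4 : ℝ) ≤ Real.exp 2 := by
    have := Real.exp_one_gt_d9
    have h : Real.exp 2 = Real.exp 1 ^ 2 := by rw [← Real.exp_nat_mul]; norm_num
    rw [h]; nlinarith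
  calc ((latticeBall n).card : ℝ) = ∑ z ∈ latticeBall n, (1 : ℝ) := by simp
    _ ≤ ∑ z ∈ latticeBall n, Real.exp (16 * n) * ∏ i, Real.exp (-(z i : ℝ) ^ 2) := by
      refine Finset.sum_le_sum fun z hz => ?_
      rw [← Real.exp_sum, ← Real.exp_add, Finset.sum_neg_distrib]
      exact Real.one_le_exp (by linarith [mem_latticeBall.1 hz])
    _ ≤ ∑ z ∈ Fintype.piFinset fun _ : Fin n =>
          Finset.Icc (-((4 * n : ℕ) : ℤ)) ((4 * n : ℕ) : ℤ),
        Real.exp (16 * n) * ∏ i, Real.exp (-(z i : ℝ) ^ 2) :=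
      Finset.sum_le_sum_of_subset_of_nonneg (Finset.filter_subset _ _) fun _ _ _ =>
        mul_nonneg (Real.exp_pos _).le (Finset.prod_nonneg fun _ _ => (Real.exp_pos _).le)
    _ = Real.exp (16 * n) * (∑ k ∈ Finset.Icc (-((4 * n : ℕ) : ℤ)) ((4 * n : ℕ) : ℤ),
        Real.exp (-(k : ℝ) ^ 2)) ^ n := by
      rw [← Finset.mul_sum]
      congr 1
      rw [← Finset.prod_univ_sum (fun _ : Fin n => Finset.Icc (-((4 * n : ℕ) : ℤ)) (4 * n : ℕ))
        (fun _ k => Real.exp (-(k : ℝ) ^ 2))]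
      simp
    _ ≤ Real.exp (16 * n) * Real.exp 2 ^ n := by
      gcongr
      exact (sum_exp_neg_sq_le _).trans h4
    _ = Real.exp (18 * n) := by
      rw [← Real.exp_nat_mul, ← Real.exp_add]
      ring_nf

/-- Nonemptiness frees one factor e^(-κ); the rest is the binomial expansion of (1 + e^(-x))^n. -/
theorem sum_nonempty_exp_le {n : ℕ} {κ x : ℝ} (hκ : 0 ≤ κ) :
    ∑ S ∈ (Finset.univ : Finset (Finset (Fin n))).filter Finset.Nonempty,
      Real.exp (-(S.card * (κ + x))) ≤ Real.exp (-κ) * Real.exp (n * Real.exp (-x)) := by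
  calc _ ≤ ∑ S ∈ (Finset.univ : Finset (Finset (Fin n))).filter Finset.Nonempty,
        Real.exp (-κ) * Real.exp (-x) ^ S.card := by
        refine Finset.sum_le_sum fun S hS => ?_
        rw [← Real.exp_nat_mul, ← Real.exp_add]
        apply Real.exp_le_exp.2
        have : (1 : ℝ) ≤ S.card := by exact_mod_cast (Finset.mem_filter.1 hS).2.card_pos
        nlinarith
    _ ≤ ∑ S : Finset (Fin n), Real.exp (-κ) * Real.exp (-x) ^ S.card :=
        Finset.sum_le_sum_of_subset_of_nonneg (Finset.filter_subset _ _)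
          fun _ _ _ => by positivity
    _ = Real.exp (-κ) * (Real.exp (-x) + 1) ^ n := by
        rw [← Finset.mul_sum]
        congr 1
        have := Finset.sum_pow_mul_eq_add_pow (Real.exp (-x)) 1 (Finset.univ : Finset (Fin n))
        simpa using this
    _ ≤ Real.exp (-κ) * Real.exp (Real.exp (-x)) ^ n := by
        gcongr
        exact Real.add_one_le_exp _
    _ = _ := by rw [← Real.exp_nat_mul]

section

variable {Ω : Type*} [MeasurableSpace Ω] {μ : Measure Ω} [IsProbabilityMeasure μ] {n : ℕ}
  {c : Fin n → Bool} {a b : ℝ} {G : Ω → SimpleGraph (Fin n)}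

theorem IsPlantedPartitionGraph.chernoff_of_abs_le
    (hG : IsPlantedPartitionGraph μ c (a / n) (b / n) G) (hb : 0 ≤ b) (hba : b ≤ a)
    (w : Fin n → Fin n → ℝ) (hw : ∀ i j, |2 * w i j| ≤ 1) (t : ℝ) :
    μ {ω | t ≤ ∑ i, ∑ j, w i j *
      (adjacency (G ω) i j - edgeProbability c (a / n) (b / n) i j)} ≤
      ENNReal.ofReal (Real.exp (a / n * (2 * ∑ i, ∑ j, w i j ^ 2) - t)) := by
  have hq : 0 ≤ b / n := by positivity
  have hqp : b / n ≤ a / n := by gcongr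
  refine (hG.chernoff (hq.trans hqp) hq w t).trans (ENNReal.ofReal_le_ofReal
    (Real.exp_le_exp.2 (sub_le_sub_right ?_ _)))
  simp only [Finset.mul_sum]
  refine Finset.sum_le_sum fun i _ => Finset.sum_le_sum fun j _ => ?_
  have h1 := (abs_le.1 (Real.abs_exp_sub_one_sub_id_le (hw i j))).2
  have h2 : 0 ≤ (Real.exp (2 * w i j) - 1 - 2 * w i j) / 2 := by
    linarith [Real.add_one_le_exp (2 * w i j)]
  refine (mul_le_mul_of_nonneg_right (edgeProbability_le hq hqp i j) h2).trans ?_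
  refine mul_le_mul_of_nonneg_left ?_ (hq.trans hqp)
  linarith

/-- Dividing the truncated products by 4√a makes the doubled weights at most 1, where e^x - 1 - x ≤
x² applies. The variance term is then at most 32n, so each z and each sign fails with probability at
most exp(-(28 + ρ)n), which beats the e^(18n) lattice points. -/
theorem IsPlantedPartitionGraph.measure_not_hasLightBound_le
    (hG : IsPlantedPartitionGraph μ c (a / n) (b / n) G) (hb : 0 ≤ b) (hba : b ≤ a) (ha : 1 ≤ a)
    (hn : 1 ≤ n) {ρ : ℝ} (hρ : 0 ≤ ρ) :
    μ {ω | ¬ HasLightBound (adjacency (G ω)) (edgeProbability c (a / n) (b / n)) a ρ} ≤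
      ENNReal.ofReal (Real.exp (-ρ)) := by
  have hsa : 0 < √a := Real.sqrt_pos.2 (by linarith)
  have hsq : √a ^ 2 = a := Real.sq_sqrt (by linarith)
  have hn0 : (0 : ℝ) < n := by exact_mod_cast hn
  have hn1 : (1 : ℝ) ≤ n := by exact_mod_cast hn
  set P := edgeProbability c (a / n) (b / n)
  let W : (Fin n → ℤ) → Fin n → Fin n → ℝ := fun z i j =>
    if |(z i : ℝ) * z j| ≤ 2 * √a then (z i : ℝ) * z j else 0
  let w : (Fin n → ℤ) → ℝ → Fin n → Fin n → ℝ := fun z σ i j => σ * (W z i j / (4 * √a))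
  let F : (Fin n → ℤ) → ℝ → Ω → ℝ := fun z σ ω =>
    ∑ i, ∑ j, w z σ i j * (adjacency (G ω) i j - P i j)
  have hWabs : ∀ z i j, |W z i j| ≤ 2 * √a := by
    intro z i j
    simp only [W]
    split_ifs with h
    · exact h
    · simp
  have hWsq : ∀ z i j, W z i j ^ 2 ≤ (z i : ℝ) ^ 2 * (z j : ℝ) ^ 2 := by
    intro z i j
    simp only [W]
    split_ifs with h
    · rw [mul_pow]
    · simpa using mul_nonneg (sq_nonneg (z i : ℝ)) (sq_nonneg (z j : ℝ))
  have hF : ∀ z ∈ latticeBall n, ∀ σ : ℝ, σ ^ 2 = 1 →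
      μ {ω | (60 + ρ) * n ≤ F z σ ω} ≤ ENNReal.ofReal (Real.exp (-(28 + ρ) * n)) := by
    intro z hz σ hσ
    have habs : |σ| = 1 := by
      rw [← sq_eq_sq₀ (abs_nonneg _) zero_le_one, sq_abs, hσ, one_pow]
    refine (hG.chernoff_of_abs_le hb hba (w z σ) ?_ _).trans
      (ENNReal.ofReal_le_ofReal (Real.exp_le_exp.2 ?_))
    · intro i j
      simp only [w]
      rw [abs_mul, abs_mul, abs_div, habs, abs_of_pos (by positivity : 0 < 4 * √a), abs_two,
        one_mul, ← mul_div_assoc, div_le_one (by positivity)]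
      linarith [hWabs z i j]
    · have h1 : ∑ i, ∑ j, w z σ i j ^ 2 ≤ (16 * n) ^ 2 / (16 * a) := by
        calc ∑ i, ∑ j, w z σ i j ^ 2 ≤ ∑ i, ∑ j, (z i : ℝ) ^ 2 * (z j : ℝ) ^ 2 / (16 * a) := by
              refine Finset.sum_le_sum fun i _ => Finset.sum_le_sum fun j _ => ?_
              simp only [w]
              rw [mul_pow, hσ, one_mul, div_pow, mul_pow, hsq]
              norm_num
              gcongr
              exact hWsq z i j
          _ = (∑ i, (z i : ℝ) ^ 2) ^ 2 / (16 * a) := by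
              rw [sq (∑ i, (z i : ℝ) ^ 2), Finset.sum_mul_sum]
              simp only [Finset.sum_div]
          _ ≤ _ := by
              gcongr
              exact mem_latticeBall.1 hz
      have h2 : a / n * (2 * ∑ i, ∑ j, w z σ i j ^ 2) ≤
          a / n * (2 * ((16 * n) ^ 2 / (16 * a))) := by
        gcongr
      have h3 : a / n * (2 * ((16 * n) ^ 2 / (16 * a))) = 32 * (n : ℝ) := by
        field_simp
        norm_num
      linarith
  have hsub : {ω | ¬ HasLightBound (adjacency (G ω)) P a ρ} ⊆
      ⋃ z ∈ latticeBall n, ({ω | (60 + ρ) * n ≤ F z 1 ω} ∪ {ω | (60 + ρ) * n ≤ F z (-1) ω}) := by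
    intro ω hω
    simp only [HasLightBound, Set.mem_ofPred_eq, not_forall, not_le] at hω
    obtain ⟨z, hz, hlt⟩ := hω
    simp only [Set.mem_iUnion]
    refine ⟨z, mem_latticeBall.2 hz, ?_⟩
    have hFe : ∀ σ : ℝ, F z σ ω = σ * (∑ i, ∑ j, W z i j *
        (adjacency (G ω) i j - P i j)) / (4 * √a) := by
      intro σ
      simp only [F, w, Finset.mul_sum, Finset.sum_div]
      refine Finset.sum_congr rfl fun i _ => Finset.sum_congr rfl fun j _ => ?_
      ring
    rcases lt_abs.1 hlt with h | h
    · left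
      simp only [Set.mem_ofPred_eq, hFe]
      rw [le_div_iff₀ (by positivity)]
      refine le_trans ?_ (h.le.trans (le_of_eq (by simp only [W, one_mul])))
      linarith
    · right
      simp only [Set.mem_ofPred_eq, hFe]
      rw [le_div_iff₀ (by positivity)]
      refine le_trans ?_ (h.le.trans (le_of_eq (by simp only [W, neg_mul, one_mul])))
      linarith
  calc _ ≤ _ := measure_mono hsub
    _ ≤ ∑ z ∈ latticeBall n, μ ({ω | (60 + ρ) * n ≤ F z 1 ω} ∪ {ω | (60 + ρ) * n ≤ F z (-1) ω}) :=
      measure_biUnion_finset_le _ _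
    _ ≤ ∑ z ∈ latticeBall n, ENNReal.ofReal (2 * Real.exp (-(28 + ρ) * n)) := by
      refine Finset.sum_le_sum fun z hz => (measure_union_le _ _).trans ?_
      rw [two_mul, ENNReal.ofReal_add (Real.exp_pos _).le (Real.exp_pos _).le]
      exact add_le_add (hF z hz 1 (by norm_num)) (hF z hz (-1) (by norm_num))
    _ = ENNReal.ofReal ((latticeBall n).card * (2 * Real.exp (-(28 + ρ) * n))) := by
      rw [Finset.sum_const, nsmul_eq_mul, ENNReal.ofReal_mul (Nat.cast_nonneg _),
        ENNReal.ofReal_natCast]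
    _ ≤ ENNReal.ofReal (Real.exp (-ρ)) := by
      apply ENNReal.ofReal_le_ofReal
      have h2 : (2 : ℝ) ≤ Real.exp 1 := by linarith [Real.add_one_le_exp (1 : ℝ)]
      calc _ ≤ Real.exp (18 * n) * (Real.exp 1 * Real.exp (-(28 + ρ) * n)) := by
            gcongr
            exact card_latticeBall_le n
        _ = Real.exp (18 * n + (1 + -(28 + ρ) * n)) := by simp only [Real.exp_add]
        _ ≤ _ := Real.exp_le_exp.2 (by nlinarith)

/-- Chernoff with the constant weight θ = (k + 1) log 2 / 2 on S × T. The doubled weight satisfies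
e^(2θ) = 2^(k+1), so the moment costs at most 2^k times the largest possible mean a/n·|S||T|. The
sets may overlap. -/
theorem IsPlantedPartitionGraph.measure_discrepancy_pair_le
    (hG : IsPlantedPartitionGraph μ c (a / n) (b / n) G) (hb : 0 ≤ b) (hba : b ≤ a)
    (k : ℕ) (S T : Finset (Fin n)) (t : ℝ) :
    μ {ω | a / n * S.card * T.card * 2 ^ k + t ≤
      (k + 1) * (Real.log 2 / 2) * ∑ i ∈ S, ∑ j ∈ T, adjacency (G ω) i j} ≤
      ENNReal.ofReal (Real.exp (-t)) := by
  classical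
  have hq : 0 ≤ b / n := by positivity
  have hqp : b / n ≤ a / n := by gcongr
  set P := edgeProbability c (a / n) (b / n)
  set θ : ℝ := (k + 1) * (Real.log 2 / 2) with hθ
  have hexp : Real.exp (2 * θ) = 2 * 2 ^ k := by
    have : 2 * θ = ((k + 1 : ℕ) : ℝ) * Real.log 2 := by rw [hθ]; push_cast; ring
    rw [this, Real.exp_nat_mul, Real.exp_log (by norm_num), pow_succ]
    ring
  have hsum : ∀ f : Fin n → Fin n → ℝ,
      ∑ i, ∑ j, (if i ∈ S ∧ j ∈ T then f i j else 0) = ∑ i ∈ S, ∑ j ∈ T, f i j := by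
    intro f
    have h : ∀ i, ∑ j, (if i ∈ S ∧ j ∈ T then f i j else 0) =
        if i ∈ S then ∑ j ∈ T, f i j else 0 := by
      intro i
      by_cases h : i ∈ S <;> simp [h]
    simp [h]
  let w : Fin n → Fin n → ℝ := fun i j => if i ∈ S ∧ j ∈ T then θ else 0
  have hw : ∀ A : Matrix (Fin n) (Fin n) ℝ, ∑ i, ∑ j, w i j * (A i j - P i j) =
      θ * ∑ i ∈ S, ∑ j ∈ T, A i j - θ * ∑ i ∈ S, ∑ j ∈ T, P i j := by
    intro A
    rw [← mul_sub, ← Finset.sum_sub_distrib]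
    simp only [← Finset.sum_sub_distrib, Finset.mul_sum]
    rw [← hsum]
    simp only [w, ite_mul, zero_mul]
  have hψ : ∑ i, ∑ j, P i j * ((Real.exp (2 * w i j) - 1 - 2 * w i j) / 2) =
      (2 ^ k - 1 / 2 - θ) * ∑ i ∈ S, ∑ j ∈ T, P i j := by
    simp only [Finset.mul_sum]
    rw [← hsum]
    refine Finset.sum_congr rfl fun i _ => Finset.sum_congr rfl fun j _ => ?_
    simp only [w]
    split_ifs
    · rw [hexp]; ring
    · simp
  have hPle : ∑ i ∈ S, ∑ j ∈ T, P i j ≤ a / n * S.card * T.card := by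
    calc _ ≤ ∑ i ∈ S, ∑ j ∈ T, a / n :=
          Finset.sum_le_sum fun i _ => Finset.sum_le_sum fun j _ => edgeProbability_le hq hqp i j
      _ = _ := by simp; ring
  have hP0 : 0 ≤ ∑ i ∈ S, ∑ j ∈ T, P i j :=
    Finset.sum_nonneg fun i _ => Finset.sum_nonneg fun j _ =>
      edgeProbability_nonneg (hq.trans hqp) hq i j
  refine le_trans (measure_mono ?_) ((hG.chernoff (hq.trans hqp) hq w
    (a / n * S.card * T.card * 2 ^ k + t - θ * ∑ i ∈ S, ∑ j ∈ T, P i j)).trans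
    (ENNReal.ofReal_le_ofReal (Real.exp_le_exp.2 ?_)))
  · intro ω hω
    simp only [Set.mem_ofPred_eq] at hω ⊢
    rw [hw]
    linarith
  · rw [hψ]
    have h2 : (0 : ℝ) < 2 ^ k := by positivity
    nlinarith [mul_le_mul_of_nonneg_right hPle h2.le]

theorem sum_exp_neg_le {κ : ℝ} (N : ℕ) :
    ∑ s ∈ Finset.range N, Real.exp (-(κ + s)) ≤ 2 * Real.exp (-κ) := by
  calc _ ≤ ∑ s ∈ Finset.range N, Real.exp (-κ) * (1 / 2) ^ s := by
        refine Finset.sum_le_sum fun s _ => ?_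
        rw [neg_add, Real.exp_add]
        gcongr
        rw [← mul_one (s : ℝ), ← mul_neg, Real.exp_nat_mul]
        gcongr
        rw [Real.exp_neg, one_div]
        gcongr
        linarith [Real.add_one_le_exp (1 : ℝ)]
    _ ≤ _ := by
        rw [← Finset.mul_sum, mul_comm]
        gcongr
        exact sum_geometric_two_le _

theorem exp_neg_three_mul_le (s : ℕ) : Real.exp (-(3 * s)) ≤ (1 / 8) ^ s := by
  rw [mul_comm, ← mul_neg, Real.exp_nat_mul]
  gcongr
  rw [Real.exp_neg, one_div]
  gcongr
  have h2 : (2 : ℝ) ≤ Real.exp 1 := by linarith [Real.add_one_le_exp (1 : ℝ)]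
  have h : Real.exp 3 = Real.exp 1 ^ 3 := by rw [← Real.exp_nat_mul]; norm_num
  rw [h]
  calc (8 : ℝ) = 2 ^ 3 := by norm_num
    _ ≤ _ := by gcongr

/-- Union bound over levels and sets. In the penalty |S|(ρ + 4s) + n 8^(-s), the part 3s|S| together
with n 8^(-s) pays for the number of sets S, and ρ + s remains because S is nonempty, which makes
the sum over s geometric. -/
theorem IsPlantedPartitionGraph.measure_not_hasDiscrepancy_le
    (hG : IsPlantedPartitionGraph μ c (a / n) (b / n) G) (hb : 0 ≤ b) (hba : b ≤ a)
    {ρ : ℝ} (hρ : 0 ≤ ρ) (L : ℕ) :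
    μ {ω | ¬ HasDiscrepancy (adjacency (G ω)) a ρ L} ≤
      ENNReal.ofReal (4 * Real.exp (-ρ)) := by
  classical
  let 𝒮 := (Finset.univ : Finset (Finset (Fin n))).filter Finset.Nonempty
  let x : ℕ → Finset (Fin n) → ℝ := fun s S => S.card * (ρ + 4 * s) + n * (1 / 8) ^ s
  let B : ℕ → ℕ → Finset (Fin n) → Finset (Fin n) → Set Ω := fun s t S T =>
    {ω | a / n * S.card * T.card * 2 ^ (s + t - L) + (x s S + x t T) ≤
      (((s + t - L : ℕ) : ℝ) + 1) * (Real.log 2 / 2) *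
        ∑ i ∈ S, ∑ j ∈ T, adjacency (G ω) i j}
  have hsub : {ω | ¬ HasDiscrepancy (adjacency (G ω)) a ρ L} ⊆
      ⋃ s ∈ Finset.range (n + 3), ⋃ t ∈ Finset.range (n + 3), ⋃ S ∈ 𝒮, ⋃ T ∈ 𝒮, B s t S T := by
    intro ω hω
    simp only [HasDiscrepancy, Set.mem_ofPred_eq, not_forall, not_le] at hω
    obtain ⟨s, t, k, hs, ht, hk, S, T, hS, hT, hlt⟩ := hω
    simp only [Set.mem_iUnion]
    refine ⟨s, Finset.mem_range.2 (by omega), t, Finset.mem_range.2 (by omega), S,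
      by simp [𝒮, hS], T, by simp [𝒮, hT], ?_⟩
    have hk' : s + t - L = k := by omega
    simp only [B, Set.mem_ofPred_eq, hk', x]
    linarith
  have hx : ∀ s, ∑ S ∈ 𝒮, Real.exp (-x s S) ≤ Real.exp (-(ρ + s)) := by
    intro s
    have h1 := sum_nonempty_exp_le (n := n) (κ := ρ + s) (x := 3 * s) (by positivity)
    calc ∑ S ∈ 𝒮, Real.exp (-x s S)
        = (∑ S ∈ 𝒮, Real.exp (-(S.card * (ρ + s + 3 * s)))) * Real.exp (-(n * (1 / 8) ^ s)) := by
          rw [Finset.sum_mul]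
          refine Finset.sum_congr rfl fun S _ => ?_
          rw [← Real.exp_add]
          congr 1
          simp only [x]
          ring
      _ ≤ (Real.exp (-(ρ + s)) * Real.exp (n * Real.exp (-(3 * s)))) *
          Real.exp (-(n * (1 / 8) ^ s)) := by gcongr
      _ ≤ (Real.exp (-(ρ + s)) * Real.exp (n * (1 / 8) ^ s)) *
          Real.exp (-(n * (1 / 8) ^ s)) := by
          gcongr
          exact exp_neg_three_mul_le s
      _ = _ := by rw [mul_assoc, ← Real.exp_add]; simp
  calc _ ≤ _ := measure_mono hsub
    _ ≤ ∑ s ∈ Finset.range (n + 3), ∑ t ∈ Finset.range (n + 3), ∑ S ∈ 𝒮, ∑ T ∈ 𝒮,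
        μ (B s t S T) := by
      refine (measure_biUnion_finset_le _ _).trans (Finset.sum_le_sum fun s _ => ?_)
      refine (measure_biUnion_finset_le _ _).trans (Finset.sum_le_sum fun t _ => ?_)
      refine (measure_biUnion_finset_le _ _).trans (Finset.sum_le_sum fun S _ => ?_)
      exact measure_biUnion_finset_le _ _
    _ ≤ ∑ s ∈ Finset.range (n + 3), ∑ t ∈ Finset.range (n + 3), ∑ S ∈ 𝒮, ∑ T ∈ 𝒮,
        ENNReal.ofReal (Real.exp (-x s S) * Real.exp (-x t T)) := by
      refine Finset.sum_le_sum fun s _ => Finset.sum_le_sum fun t _ =>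
        Finset.sum_le_sum fun S _ => Finset.sum_le_sum fun T _ => ?_
      rw [← Real.exp_add, ← neg_add]
      exact hG.measure_discrepancy_pair_le hb hba _ _ _ _
    _ = ENNReal.ofReal (∑ s ∈ Finset.range (n + 3), ∑ t ∈ Finset.range (n + 3), ∑ S ∈ 𝒮, ∑ T ∈ 𝒮,
        (Real.exp (-x s S) * Real.exp (-x t T))) := by
      rw [ENNReal.ofReal_sum_of_nonneg (fun _ _ => by positivity)]
      refine Finset.sum_congr rfl fun s _ => ?_
      rw [ENNReal.ofReal_sum_of_nonneg (fun _ _ => by positivity)]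
      refine Finset.sum_congr rfl fun s _ => ?_
      rw [ENNReal.ofReal_sum_of_nonneg (fun _ _ => by positivity)]
      refine Finset.sum_congr rfl fun s _ => ?_
      rw [ENNReal.ofReal_sum_of_nonneg (fun _ _ => by positivity)]
    _ ≤ _ := by
      apply ENNReal.ofReal_le_ofReal
      simp only [← Finset.sum_mul_sum]
      calc _ ≤ (∑ s ∈ Finset.range (n + 3), Real.exp (-(ρ + s))) *
            ∑ s ∈ Finset.range (n + 3), Real.exp (-(ρ + s)) := by
            gcongr with s _ s _
            · exact hx s
            · exact hx s
        _ ≤ (2 * Real.exp (-ρ)) * (2 * Real.exp (-ρ)) := by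
            gcongr
            · exact sum_exp_neg_le _
            · exact sum_exp_neg_le _
        _ ≤ 4 * Real.exp (-ρ) := by
            have h1 : Real.exp (-ρ) ≤ 1 := Real.exp_le_one_iff.2 (by linarith)
            have h2 := Real.exp_pos (-ρ)
            nlinarith

/-- Weight 1/2 on a single row becomes 1 after doubling, so the total exponent is D(e - 1)/2 - 9a/10
with D ≤ a the expected degree; it is nonpositive since (e - 1)/2 < 0.86. -/
theorem IsPlantedPartitionGraph.mgf_weightedDegree_le
    (hG : IsPlantedPartitionGraph μ c (a / n) (b / n) G) (hb : 0 ≤ b) (hba : b ≤ a)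
    (i : Fin n) :
    Integrable (fun ω => Real.exp (weightedDegree (adjacency (G ω)) i / 2 - 9 / 10 * a)) μ ∧
    ∫ ω, Real.exp (weightedDegree (adjacency (G ω)) i / 2 - 9 / 10 * a) ∂μ ≤ 1 := by
  have hn : (0 : ℝ) < n := by exact_mod_cast (Fin.pos i)
  have hq : 0 ≤ b / n := by positivity
  have hqp : b / n ≤ a / n := by gcongr
  set P := edgeProbability c (a / n) (b / n)
  let w : Fin n → Fin n → ℝ := fun k _ => if k = i then 1 / 2 else 0
  let D : ℝ := ∑ j, P i j
  have hD : D ≤ a := by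
    calc D ≤ ∑ j : Fin n, a / n := Finset.sum_le_sum fun j _ => edgeProbability_le hq hqp i j
      _ = a := by simp; field_simp
  have hD0 : 0 ≤ D := Finset.sum_nonneg fun j _ => edgeProbability_nonneg (hq.trans hqp) hq i j
  have hw : ∀ A : Matrix (Fin n) (Fin n) ℝ, ∑ k, ∑ j, w k j * (A k j - P k j) =
      weightedDegree A i / 2 - D / 2 := by
    intro A
    simp only [w, ite_mul, zero_mul, weightedDegree, D]
    rw [Finset.sum_eq_single i (by intro k _ hk; simp [hk]) (by simp)]
    simp only [if_true, ← Finset.mul_sum, Finset.sum_sub_distrib]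
    ring
  have hψ : ∑ k, ∑ j, P k j * ((Real.exp (2 * w k j) - 1 - 2 * w k j) / 2) =
      D * ((Real.exp 1 - 2) / 2) := by
    simp only [w, D]
    rw [Finset.sum_eq_single i (by intro k _ hk; simp [hk]) (by simp), Finset.sum_mul]
    refine Finset.sum_congr rfl fun j _ => ?_
    norm_num
    left; ring
  have hfun : (fun ω => Real.exp (weightedDegree (adjacency (G ω)) i / 2 - 9 / 10 * a)) =
      fun ω => Real.exp (D / 2 - 9 / 10 * a) * Real.exp (1 * ∑ k, ∑ j, w k j *
        (adjacency (G ω) k j - P k j)) := by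
    ext ω
    rw [hw, ← Real.exp_add]
    congr 1
    ring
  rw [hfun]
  refine ⟨(hG.integrable_exp_sum w P).const_mul _, ?_⟩
  rw [integral_const_mul]
  refine (mul_le_mul_of_nonneg_left (hG.integral_exp_sum_le (hq.trans hqp) hq w)
    (Real.exp_pos _).le).trans ?_
  rw [hψ, ← Real.exp_add]
  apply Real.exp_le_one_iff.2
  have := Real.exp_one_lt_d9
  nlinarith

theorem IsPlantedPartitionGraph.measure_not_hasDegreeTail_le
    (hG : IsPlantedPartitionGraph μ c (a / n) (b / n) G) (hb : 0 ≤ b) (hba : b ≤ a)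
    (hn : 1 ≤ n) (ρ : ℝ) :
    μ {ω | ¬ HasDegreeTail (adjacency (G ω)) a ρ} ≤ ENNReal.ofReal (Real.exp (-ρ)) := by
  have hn0 : (0 : ℝ) < n := by exact_mod_cast hn
  let F : Ω → ℝ := fun ω =>
    ∑ i, Real.exp (weightedDegree (adjacency (G ω)) i / 2 - 9 / 10 * a)
  have hint : Integrable F μ :=
    integrable_finsetSum _ fun i _ => (hG.mgf_weightedDegree_le hb hba i).1
  have hle : ∫ ω, F ω ∂μ ≤ n := by
    simp only [F]
    rw [integral_finsetSum _ fun i _ => (hG.mgf_weightedDegree_le hb hba i).1]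
    calc _ ≤ ∑ i : Fin n, (1 : ℝ) :=
          Finset.sum_le_sum fun i _ => (hG.mgf_weightedDegree_le hb hba i).2
      _ = n := by simp
  have hM := mul_meas_ge_le_integral_of_nonneg (μ := μ) (ae_of_all _ fun ω =>
    (Finset.sum_nonneg fun _ _ => (Real.exp_pos _).le : 0 ≤ F ω)) hint (n * Real.exp ρ)
  calc _ ≤ μ {ω | n * Real.exp ρ ≤ F ω} := by
        apply measure_mono
        intro ω hω
        simp only [HasDegreeTail, Set.mem_ofPred_eq, not_le] at hω ⊢
        exact hω.le
    _ ≤ _ := by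
        rw [← ENNReal.ofReal_toReal (measure_ne_top μ _)]
        apply ENNReal.ofReal_le_ofReal
        rw [Real.exp_neg, ← one_div, le_div_iff₀ (Real.exp_pos _)]
        have h1 := hM.trans hle
        rw [mul_assoc] at h1
        rw [mul_comm]
        exact (mul_le_iff_le_one_right hn0).1 h1

end

/-! ### Dyadic summation over pairs of levels. -/

theorem sum_add_one_div_two_pow_le (m : ℕ) :
    ∑ i ∈ Finset.range m, ((i : ℝ) + 1) / 2 ^ i ≤ 4 := by
  have h : ∑ i ∈ Finset.range m, ((i : ℝ) + 1) / 2 ^ i = 4 - (2 * m + 4) / 2 ^ m := by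
    induction m with
    | zero => norm_num
    | succ m ih =>
      rw [Finset.sum_range_succ, ih, pow_succ]
      push_cast
      field_simp
      ring
  rw [h]
  have : (0 : ℝ) ≤ (2 * m + 4) / 2 ^ m := by positivity
  linarith

/-- Pointwise bound behind `sum_heavy_levels_le`. -/
theorem heavy_level_le {n a ρ e ks kt : ℝ} {L s t : ℕ} (hn : 0 < n)
    (ha : 0 ≤ a) (hρ : 0 ≤ ρ) (hL : L ≤ s + t) (he : 0 ≤ e) (hks : 0 ≤ ks) (hkt : 0 ≤ kt)
    (hs : e ≤ 2 * a * ks) (ht : e ≤ 2 * a * kt)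
    (hdisc : (((s + t - L : ℕ) : ℝ) + 1) * (Real.log 2 / 2) * e ≤ a / n * ks * kt * 2 ^ (s + t - L)
      + ks * (ρ + 4 * s) + kt * (ρ + 4 * t) + n * (1 / 8) ^ s + n * (1 / 8) ^ t) :
    2 ^ (s + t) * e ≤
      ((if t + L < s then 2 * a * ks * 2 ^ (s + t) else 0) +
        (if s + L < t then 2 * a * kt * 2 ^ (s + t) else 0)) +
      (3 * (a / n) / 2 ^ L * ((ks * 4 ^ s) * (kt * 4 ^ t)) +
      ((if s ≤ t + L then 3 * 2 ^ L * ((((t + L - s : ℕ) : ℝ) + 1) / 2 ^ (t + L - s)) *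
          (kt * 4 ^ t * (ρ + 2) + n * (1 / 2) ^ t) else 0) +
        (if t ≤ s + L then 3 * 2 ^ L * ((((s + L - t : ℕ) : ℝ) + 1) / 2 ^ (s + L - t)) *
          (ks * 4 ^ s * (ρ + 2) + n * (1 / 2) ^ s) else 0))) := by
  -- With i = t + L - s and j = s + t - L one has i + j = 2t, so 2^(s+t) = 2^L 4^t / 2^i and
  -- (i+1)(j+1) ≥ 2t + 1. Thus 1/(j+1) is traded for (i+1)/(2t+1), whose denominator absorbs the 4t
  -- in the penalty, and the surviving (i+1)/2^i is summable over s.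
  have hU : ∀ (k : ℝ) (s t : ℕ), 0 ≤ k → s ≤ t + L → L ≤ s + t →
      2 ^ (s + t) / (((s + t - L : ℕ) : ℝ) + 1) * (k * (ρ + 4 * t) + n * (1 / 8) ^ t) ≤
      2 ^ L * ((((t + L - s : ℕ) : ℝ) + 1) / 2 ^ (t + L - s)) *
          (k * 4 ^ t * (ρ + 2) + n * (1 / 2) ^ t) := by
    intro k s t hk h1 h2
    obtain ⟨i, hi⟩ := Nat.exists_eq_add_of_le h1
    obtain ⟨j, hj⟩ := Nat.exists_eq_add_of_le h2
    have e1 : t + L - s = i := by omega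
    have e2 : s + t - L = j := by omega
    have e3 : i + j = 2 * t := by omega
    rw [e1, e2]
    have e4 : (2 : ℝ) ^ (s + t) = 2 ^ L * 4 ^ t / 2 ^ i := by
      rw [eq_div_iff (by positivity), show (4 : ℝ) = 2 ^ 2 by norm_num, ← pow_mul, ← pow_add,
        ← pow_add]
      congr 1
      omega
    have e5 : (1 : ℝ) / (j + 1) ≤ (i + 1) / (2 * t + 1) := by
      rw [div_le_div_iff₀ (by positivity) (by positivity)]
      have : (i : ℝ) + j = 2 * t := by exact_mod_cast e3
      have hij : (0 : ℝ) ≤ i * j := by positivity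
      nlinarith
    have e6 : (1 : ℝ) / (2 * t + 1) * (k * (ρ + 4 * t) + n * (1 / 8) ^ t) ≤
        k * (ρ + 2) + n * (1 / 8) ^ t := by
      rw [one_div, inv_mul_le_iff₀ (by positivity)]
      have h0 : (0 : ℝ) ≤ t := t.cast_nonneg
      have h3 : (0 : ℝ) ≤ n * (1 / 8) ^ t := by positivity
      have h4 : 0 ≤ k * (ρ * t) := by positivity
      nlinarith [mul_nonneg h0 h3]
    have e7 : (4 : ℝ) ^ t * (1 / 8) ^ t = (1 / 2) ^ t := by rw [← mul_pow]; norm_num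
    have hpos : 0 ≤ k * (ρ + 4 * t) + n * (1 / 8) ^ t := by positivity
    calc 2 ^ (s + t) / ((j : ℝ) + 1) * (k * (ρ + 4 * t) + n * (1 / 8) ^ t)
        = 2 ^ L * 4 ^ t / 2 ^ i * (1 / ((j : ℝ) + 1)) *
          (k * (ρ + 4 * t) + n * (1 / 8) ^ t) := by rw [e4]; ring
      _ ≤ 2 ^ L * 4 ^ t / 2 ^ i * ((i + 1) / (2 * t + 1)) *
          (k * (ρ + 4 * t) + n * (1 / 8) ^ t) := by gcongr
      _ = 2 ^ L * 4 ^ t / 2 ^ i * (i + 1) * (1 / (2 * t + 1) *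
          (k * (ρ + 4 * t) + n * (1 / 8) ^ t)) := by ring
      _ ≤ 2 ^ L * 4 ^ t / 2 ^ i * (i + 1) * (k * (ρ + 2) + n * (1 / 8) ^ t) := by gcongr
      _ = 2 ^ L * ((i + 1) / 2 ^ i) * (k * 4 ^ t * (ρ + 2) + n * (4 ^ t * (1 / 8) ^ t)) := by
          ring
      _ = _ := by rw [e7]
  -- If the levels differ by more than L, the degree bound on the smaller-cardinality scale (the
  -- higher level) suffices; otherwise the discrepancy inequality is used, with log 2 / 2 ≥ 1/3.
  by_cases h1 : t + L < s
  · have h2 : ¬ s ≤ t + L := by omega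
    have h3 : t ≤ s + L := by omega
    have h4 : ¬ s + L < t := by omega
    simp only [h1, h2, h3, h4, if_true, if_false]
    have h5 : (2 : ℝ) ^ (s + t) * e ≤ 2 ^ (s + t) * (2 * a * ks) := by gcongr
    have h6 : 0 ≤ 3 * (a / n) / 2 ^ L * ((ks * 4 ^ s) * (kt * 4 ^ t)) := by positivity
    have h7 : 0 ≤ 3 * 2 ^ L * ((((s + L - t : ℕ) : ℝ) + 1) / 2 ^ (s + L - t)) *
          (ks * 4 ^ s * (ρ + 2) + n * (1 / 2) ^ s) := by positivity
    linarith
  by_cases h1' : s + L < t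
  · have h2 : s ≤ t + L := by omega
    have h3 : ¬ t ≤ s + L := by omega
    simp only [h1, h1', h2, h3, if_true, if_false]
    have h5 : (2 : ℝ) ^ (s + t) * e ≤ 2 ^ (s + t) * (2 * a * kt) := by gcongr
    have h6 : 0 ≤ 3 * (a / n) / 2 ^ L * ((ks * 4 ^ s) * (kt * 4 ^ t)) := by positivity
    have h7 : 0 ≤ 3 * 2 ^ L * ((((t + L - s : ℕ) : ℝ) + 1) / 2 ^ (t + L - s)) *
          (kt * 4 ^ t * (ρ + 2) + n * (1 / 2) ^ t) := by positivity
    linarith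
  · have h2 : s ≤ t + L := by omega
    have h3 : t ≤ s + L := by omega
    simp only [h1, h1', h2, h3, if_true, if_false]
    have u1 := hU kt s t hkt h2 hL
    have u2 := hU ks t s hks h3 (by omega)
    rw [add_comm t s] at u2
    set j : ℕ := s + t - L with hj
    have hlog : 1 / 3 ≤ Real.log 2 / 2 := by linarith [Real.log_two_gt_d9]
    have h4 : e ≤ 3 / ((j : ℝ) + 1) * (a / n * ks * kt * 2 ^ j
      + ks * (ρ + 4 * s) + kt * (ρ + 4 * t) + n * (1 / 8) ^ s + n * (1 / 8) ^ t) := by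
      rw [div_mul_eq_mul_div, le_div_iff₀ (by positivity)]
      have : (1 : ℝ) / 3 * (((j : ℝ) + 1) * e) ≤ Real.log 2 / 2 * (((j : ℝ) + 1) * e) := by
        gcongr
      linarith
    have h5 : (2 : ℝ) ^ (s + t) * 2 ^ j = 4 ^ s * 4 ^ t / 2 ^ L := by
      rw [eq_div_iff (by positivity), show (4 : ℝ) = 2 ^ 2 by norm_num, ← pow_mul, ← pow_mul,
        ← pow_add, ← pow_add, ← pow_add]
      congr 1
      omega
    have h6 : (1 : ℝ) / ((j : ℝ) + 1) ≤ 1 := by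
      rw [div_le_one (by positivity)]
      linarith [(Nat.cast_nonneg j : (0 : ℝ) ≤ j)]
    calc 2 ^ (s + t) * e ≤ 2 ^ (s + t) * (3 / ((j : ℝ) + 1) * (a / n * ks * kt * 2 ^ j
      + ks * (ρ + 4 * s) + kt * (ρ + 4 * t) + n * (1 / 8) ^ s + n * (1 / 8) ^ t)) := by gcongr
      _ = 3 * (1 / ((j : ℝ) + 1) * (a / n * ks * kt * (2 ^ (s + t) * 2 ^ j))) +
        3 * (2 ^ (s + t) / ((j : ℝ) + 1) * (kt * (ρ + 4 * t) + n * (1 / 8) ^ t)) +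
        3 * (2 ^ (s + t) / ((j : ℝ) + 1) * (ks * (ρ + 4 * s) + n * (1 / 8) ^ s)) := by ring
      _ ≤ 3 * (1 * (a / n * ks * kt * (2 ^ (s + t) * 2 ^ j))) +
        3 * (2 ^ (s + t) / ((j : ℝ) + 1) * (kt * (ρ + 4 * t) + n * (1 / 8) ^ t)) +
        3 * (2 ^ (s + t) / ((j : ℝ) + 1) * (ks * (ρ + 4 * s) + n * (1 / 8) ^ s)) := by gcongr
      _ ≤ _ := by
        rw [h5]
        have h7 : 3 * (1 * (a / n * ks * kt * (4 ^ s * 4 ^ t / 2 ^ L))) =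
          3 * (a / n) / 2 ^ L * ((ks * 4 ^ s) * (kt * 4 ^ t)) := by ring
        linarith

/-- Dyadic summation of the edge counts between level sets whose levels add up to at least `L`. -/
theorem sum_heavy_levels_le {n a ρ : ℝ} {L N : ℕ} {k : ℕ → ℝ} {e : ℕ → ℕ → ℝ} (hn : 0 < n)
    (ha : 0 < a) (hρ : 0 ≤ ρ) (hL1 : 2 ^ L ≤ √a) (hL2 : √a ≤ 2 ^ (L + 1))
    (hk : ∀ s, 0 ≤ k s) (hksum : ∑ s ∈ Finset.range N, k s * 4 ^ s ≤ 16 * n)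
    (he : ∀ s t, 0 ≤ e s t) (hs : ∀ s t, e s t ≤ 2 * a * k s) (ht : ∀ s t, e s t ≤ 2 * a * k t)
    (hdisc : ∀ s < N, ∀ t < N, L ≤ s + t →
      (((s + t - L : ℕ) : ℝ) + 1) * (Real.log 2 / 2) * e s t ≤
        a / n * k s * k t * 2 ^ (s + t - L)
        + k s * (ρ + 4 * s) + k t * (ρ + 4 * t) + n * (1 / 8) ^ s + n * (1 / 8) ^ t) :
    ∑ s ∈ Finset.range N, ∑ t ∈ Finset.range N,
      (if L ≤ s + t then 2 ^ (s + t) * e s t else 0) ≤ (2500 + 400 * ρ) * n * √a := by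
  have hsa : 0 < √a := Real.sqrt_pos.2 ha
  have haL : a / 2 ^ L ≤ 2 * √a := by
    rw [div_le_iff₀ (by positivity)]
    calc a = √a * √a := (Real.mul_self_sqrt ha.le).symm
      _ ≤ √a * 2 ^ (L + 1) := by gcongr
      _ = _ := by rw [pow_succ]; ring
  -- T1 collects the degree bounds, Q the mean term of the discrepancy inequality, U its penalties.
  -- Their sums are at most 64, 1536 and 12(16ρ + 34) times n√a; T1 and U enter twice by symmetry.
  let T1 : ℕ → ℕ → ℝ := fun s t => if t + L < s then 2 * a * k s * 2 ^ (s + t) else 0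
  let Q : ℕ → ℕ → ℝ := fun s t => 3 * (a / n) / 2 ^ L * ((k s * 4 ^ s) * (k t * 4 ^ t))
  let V : ℕ → ℝ := fun t => k t * 4 ^ t * (ρ + 2) + n * (1 / 2) ^ t
  let U : ℕ → ℕ → ℝ := fun s t => if s ≤ t + L then
    3 * 2 ^ L * ((((t + L - s : ℕ) : ℝ) + 1) / 2 ^ (t + L - s)) * V t else 0
  have hV : ∀ t, 0 ≤ V t := fun t => by have := hk t; positivity
  have hpt : ∀ s ∈ Finset.range N, ∀ t ∈ Finset.range N,
      (if L ≤ s + t then 2 ^ (s + t) * e s t else 0) ≤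
        (T1 s t + T1 t s) + (Q s t + (U s t + U t s)) := by
    intro s hsN t htN
    split_ifs with h
    · have := heavy_level_le hn ha.le hρ h (he s t) (hk s) (hk t) (hs s t) (ht s t)
        (hdisc s (Finset.mem_range.1 hsN) t (Finset.mem_range.1 htN) h)
      simpa only [T1, Q, U, V, add_comm t s] using this
    · have hks := hk s
      have hkt := hk t
      have hVs := hV s
      have hVt := hV t
      have : ∀ (p : Prop) [Decidable p] (x : ℝ), 0 ≤ x → 0 ≤ if p then x else 0 := by
        intro p _ x hx
        split_ifs <;> simp [hx]
      refine add_nonneg (add_nonneg ?_ ?_) (add_nonneg ?_ (add_nonneg ?_ ?_))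
      · exact this _ _ (by positivity)
      · exact this _ _ (by positivity)
      · simp only [Q]; positivity
      · exact this _ _ (by positivity)
      · exact this _ _ (by positivity)
  have hT1 : ∑ s ∈ Finset.range N, ∑ t ∈ Finset.range N, T1 s t ≤ 64 * n * √a := by
    have h1 : ∀ s, ∑ t ∈ Finset.range N, T1 s t ≤ 2 * (a / 2 ^ L) * (k s * 4 ^ s) := by
      intro s
      have hks := hk s
      calc ∑ t ∈ Finset.range N, T1 s t
          = ∑ t ∈ (Finset.range N).filter (fun t => t + L < s), 2 * a * k s * 2 ^ (s + t) := by
            rw [Finset.sum_filter]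
        _ ≤ ∑ t ∈ Finset.range (s - L), 2 * a * k s * 2 ^ (s + t) := by
            refine Finset.sum_le_sum_of_subset_of_nonneg ?_ fun _ _ _ => by positivity
            intro t
            simp only [Finset.mem_filter, Finset.mem_range]
            omega
        _ = 2 * a * k s * 2 ^ s * ∑ t ∈ Finset.range (s - L), (2 : ℝ) ^ t := by
            rw [Finset.mul_sum]
            exact Finset.sum_congr rfl fun t _ => by rw [pow_add]; ring
        _ ≤ 2 * a * k s * 2 ^ s * (2 ^ s / 2 ^ L) := by
            gcongr
            rw [geom_sum_eq (by norm_num)]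
            rcases le_total L s with h | h
            · rw [pow_sub₀ _ (by norm_num) h, ← div_eq_mul_inv]
              norm_num
            · rw [Nat.sub_eq_zero_of_le h, pow_zero, sub_self, zero_div]
              positivity
        _ = 2 * (a / 2 ^ L) * (k s * 4 ^ s) := by
            rw [show (4 : ℝ) = 2 * 2 by norm_num, mul_pow]
            ring
    calc _ ≤ ∑ s ∈ Finset.range N, 2 * (a / 2 ^ L) * (k s * 4 ^ s) :=
          Finset.sum_le_sum fun s _ => h1 s
      _ = 2 * (a / 2 ^ L) * ∑ s ∈ Finset.range N, k s * 4 ^ s := by rw [Finset.mul_sum]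
      _ ≤ 2 * (2 * √a) * (16 * n) := by
          gcongr
          exact Finset.sum_nonneg fun s _ => mul_nonneg (hk s) (by positivity)
      _ = _ := by ring
  have hksum0 : 0 ≤ ∑ s ∈ Finset.range N, k s * 4 ^ s :=
    Finset.sum_nonneg fun s _ => mul_nonneg (hk s) (by positivity)
  have hQ : ∑ s ∈ Finset.range N, ∑ t ∈ Finset.range N, Q s t ≤ 1536 * n * √a := by
    calc _ = 3 * (a / 2 ^ L) / n * ((∑ s ∈ Finset.range N, k s * 4 ^ s) *
          ∑ s ∈ Finset.range N, k s * 4 ^ s) := by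
          rw [Finset.sum_mul_sum]
          simp only [Finset.mul_sum, Q]
          refine Finset.sum_congr rfl fun s _ => Finset.sum_congr rfl fun t _ => ?_
          ring
      _ ≤ 3 * (2 * √a) / n * ((16 * n) * (16 * n)) := by gcongr
      _ = _ := by field_simp; norm_num
  have hU : ∑ s ∈ Finset.range N, ∑ t ∈ Finset.range N, U s t ≤
      12 * (16 * ρ + 34) * n * √a := by
    rw [Finset.sum_comm]
    have h1 : ∀ t, ∑ s ∈ Finset.range N, U s t ≤ 3 * 2 ^ L * 4 * V t := by
      intro t
      have hVt := hV t
      calc ∑ s ∈ Finset.range N, U s t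
          = ∑ s ∈ (Finset.range N).filter (fun s => s ≤ t + L),
            3 * 2 ^ L * ((((t + L - s : ℕ) : ℝ) + 1) / 2 ^ (t + L - s)) * V t := by
            rw [Finset.sum_filter]
        _ ≤ ∑ s ∈ Finset.range (t + L + 1),
            3 * 2 ^ L * ((((t + L - s : ℕ) : ℝ) + 1) / 2 ^ (t + L - s)) * V t := by
            refine Finset.sum_le_sum_of_subset_of_nonneg ?_ fun _ _ _ => by positivity
            intro s
            simp only [Finset.mem_filter, Finset.mem_range]
            omega
        _ = 3 * 2 ^ L * (∑ s ∈ Finset.range (t + L + 1), ((s : ℝ) + 1) / 2 ^ s) * V t := by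
            rw [← Finset.sum_range_reflect (fun s : ℕ => ((s : ℝ) + 1) / 2 ^ s), Finset.mul_sum,
              Finset.sum_mul]
            exact Finset.sum_congr rfl fun s _ => by simp
        _ ≤ _ := by
            gcongr
            exact sum_add_one_div_two_pow_le _
    have h2 : ∑ t ∈ Finset.range N, V t ≤ 16 * n * (ρ + 2) + n * 2 := by
      simp only [V, Finset.sum_add_distrib, ← Finset.sum_mul, ← Finset.mul_sum]
      gcongr
      exact sum_geometric_two_le _
    calc _ ≤ ∑ t ∈ Finset.range N, 3 * 2 ^ L * 4 * V t := Finset.sum_le_sum fun t _ => h1 t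
      _ = 3 * 2 ^ L * 4 * ∑ t ∈ Finset.range N, V t := by rw [Finset.mul_sum]
      _ ≤ 3 * √a * 4 * (16 * n * (ρ + 2) + n * 2) := by
          gcongr
          exact Finset.sum_nonneg fun t _ => hV t
      _ = _ := by ring
  have hT1' := hT1
  have hU' := hU
  rw [Finset.sum_comm] at hT1' hU'
  refine (Finset.sum_le_sum fun s hs => Finset.sum_le_sum fun t ht => hpt s hs t ht).trans ?_
  simp only [Finset.sum_add_distrib]
  have : 0 ≤ ρ * n * √a := by positivity
  have : 0 ≤ n * √a := by positivity
  nlinarith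

/-! ### The quadratic form of a regularization at integer vectors. -/

/-- The expected adjacency matrix of the planted partition model, with the diagonal filled in. -/
def blockMatrix {n : ℕ} (c : Fin n → Bool) (p q : ℝ) : Matrix (Fin n) (Fin n) ℝ :=
  fun i j => if c i = c j then p else q

section

variable {n : ℕ} {A A' : Matrix (Fin n) (Fin n) ℝ}

/-- For x > 2a the exponent x/2 - 9a/10 exceeds x/20, so the exponential moment also controls the
sum of the large degrees, not just their number. -/
theorem weightedDegree_le_of_lt {a x : ℝ} (h : 2 * a < x) :
    x ≤ 20 * Real.exp (x / 2 - 9 / 10 * a) := by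
  have h1 : x / 20 ≤ Real.exp (x / 20) := by linarith [Real.add_one_le_exp (x / 20)]
  have h2 : Real.exp (x / 20) ≤ Real.exp (x / 2 - 9 / 10 * a) :=
    Real.exp_le_exp.2 (by linarith)
  linarith

/-- A degree regularization removes little total weight. -/
theorem HasDegreeTail.sum_sub_le {a ρ : ℝ} (hA : HasDegreeTail A a ρ) (hA0 : ∀ i j, 0 ≤ A i j)
    (hAs : ∀ i j, A i j = A j i) (h : IsDegreeRegularization A (2 * a) A') :
    ∑ i, ∑ j, (A i j - A' i j) ≤ 40 * Real.exp ρ * n := by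
  let D : Fin n → ℝ := fun i => if 2 * a < weightedDegree A i then 1 else 0
  -- Weight is lost only at pairs touching a vertex of degree above 2a; charging it to that endpoint
  -- bounds the loss by twice the sum of the large degrees.
  have hpt : ∀ i j, A i j - A' i j ≤ D i * A i j + D j * A j i := by
    intro i j
    have h1 := h.eq_of_degree_le i j
    have h2 := h.nonneg i j
    have h3 := hA0 i j
    rw [hAs j i]
    simp only [D]
    split_ifs with hi hj hj
    · linarith
    · linarith
    · linarith
    · rw [h1 (not_lt.1 hi) (not_lt.1 hj)]
      linarith
  have hD : ∑ i, ∑ j, D i * A i j ≤ 20 * Real.exp ρ * n := by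
    calc ∑ i, ∑ j, D i * A i j
        ≤ ∑ i, 20 * Real.exp (weightedDegree A i / 2 - 9 / 10 * a) := by
          refine Finset.sum_le_sum fun i _ => ?_
          rw [← Finset.mul_sum]
          simp only [D]
          split_ifs with hi
          · rw [one_mul]; exact weightedDegree_le_of_lt hi
          · rw [zero_mul]; positivity
      _ ≤ 20 * (n * Real.exp ρ) := by
          rw [← Finset.mul_sum]
          exact mul_le_mul_of_nonneg_left hA (by norm_num)
      _ = _ := by ring
  calc _ ≤ ∑ i, ∑ j, (D i * A i j + D j * A j i) :=
        Finset.sum_le_sum fun i _ => Finset.sum_le_sum fun j _ => hpt i j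
    _ = (∑ i, ∑ j, D i * A i j) + ∑ i, ∑ j, D j * A j i := by
        simp only [Finset.sum_add_distrib]
    _ ≤ _ := by
        rw [Finset.sum_comm (f := fun i j => D j * A j i)]
        linarith

theorem sum_sum_ite_mem {ι : Type*} [Fintype ι] [DecidableEq ι] (Z : Finset ι) (f : ι → ι → ℝ) :
    ∑ i, ∑ j, (if i ∈ Z then if j ∈ Z then f i j else 0 else 0) = ∑ i ∈ Z, ∑ j ∈ Z, f i j := by
  have h : ∀ i, ∑ j, (if i ∈ Z then if j ∈ Z then f i j else 0 else 0) =
      if i ∈ Z then ∑ j ∈ Z, f i j else 0 := by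
    intro i
    by_cases h : i ∈ Z <;> simp [h]
  simp [h]

/-- A sum over pairs, arranged by the levels of the two entries. -/
theorem sum_sum_eq_sum_levels {ι : Type*} (Z : Finset ι) (lev : ι → ℕ) {N : ℕ}
    (hlev : ∀ i ∈ Z, lev i < N) (f : ℕ → ℕ → ι → ι → ℝ) :
    ∑ i ∈ Z, ∑ j ∈ Z, f (lev i) (lev j) i j =
      ∑ s ∈ Finset.range N, ∑ t ∈ Finset.range N,
        ∑ i ∈ Z with lev i = s, ∑ j ∈ Z with lev j = t, f s t i j := by
  have h1 : ∀ g : ι → ℝ, ∑ s ∈ Finset.range N, ∑ i ∈ Z with lev i = s, g i = ∑ i ∈ Z, g i :=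
    fun g => Finset.sum_fiberwise_of_maps_to (fun i hi => Finset.mem_range.2 (hlev i hi)) g
  rw [← h1]
  refine Finset.sum_congr rfl fun s _ => ?_
  refine Eq.trans (Finset.sum_congr rfl fun i hi => ?_) Finset.sum_comm
  rw [← h1]
  refine Finset.sum_congr rfl fun t _ => Finset.sum_congr rfl fun j hj => ?_
  rw [(Finset.mem_filter.1 hi).2, (Finset.mem_filter.1 hj).2]

set_option maxHeartbeats 800000 in
/-- The contribution of the pairs with a large product of coordinates to the quadratic form of a
degree regularization. -/
theorem HasDiscrepancy.sum_heavy_le {a ρ : ℝ} {L : ℕ} (hA : HasDiscrepancy A a ρ L)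
    (hn : 1 ≤ n) (ha : 0 < a) (hρ : 0 ≤ ρ) (hL1 : 2 ^ L ≤ √a) (hL2 : √a ≤ 2 ^ (L + 1))
    (h : IsDegreeRegularization A (2 * a) A') {z : Fin n → ℤ}
    (hz : ∑ i, (z i : ℝ) ^ 2 ≤ 16 * n) :
    ∑ i, ∑ j, (if |(z i : ℝ) * z j| ≤ 2 * √a then 0 else |(z i : ℝ) * z j|) * A' i j ≤
      4 * ((2500 + 400 * ρ) * n * √a) := by
  classical
  have hn0 : (0 : ℝ) < n := by exact_mod_cast hn
  -- Level s holds the coordinates with 2^s ≤ |z i| < 2^(s+1). Zero coordinates are excluded through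
  -- `Z`, as `Nat.log` would put them in level 0.
  let lev : Fin n → ℕ := fun i => Nat.log 2 (z i).natAbs
  let Z : Finset (Fin n) := Finset.univ.filter fun i => z i ≠ 0
  let D : ℕ → Finset (Fin n) := fun s => Z.filter fun i => lev i = s
  let e : ℕ → ℕ → ℝ := fun s t => ∑ i ∈ D s, ∑ j ∈ D t, A' i j
  have hcast : ∀ i, ((z i).natAbs : ℝ) = |(z i : ℝ)| := fun i => by
    rw [Nat.cast_natAbs, Int.cast_abs]
  have hlow : ∀ i ∈ Z, (2 : ℝ) ^ lev i ≤ |(z i : ℝ)| := by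
    intro i hi
    rw [← hcast]
    exact_mod_cast Nat.pow_log_le_self 2 (Int.natAbs_ne_zero.2 (Finset.mem_filter.1 hi).2)
  have hup : ∀ i, |(z i : ℝ)| < 2 ^ (lev i + 1) := by
    intro i
    rw [← hcast]
    exact_mod_cast Nat.lt_pow_succ_log_self (by norm_num) _
  have hlevN : ∀ i ∈ Z, lev i < n + 3 := by
    intro i hi
    have h1 : (z i : ℝ) ^ 2 ≤ 16 * n :=
      (Finset.single_le_sum (f := fun i => (z i : ℝ) ^ 2) (fun _ _ => sq_nonneg _)
        (Finset.mem_univ i)).trans hz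
    have h2 : ((2 : ℝ) ^ lev i) ^ 2 ≤ (z i : ℝ) ^ 2 := by
      rw [← sq_abs (z i : ℝ)]
      gcongr
      exact hlow i hi
    have h3 : (n : ℝ) < 2 ^ n := by exact_mod_cast Nat.lt_two_pow_self
    have h4 : (2 : ℝ) ^ n ≤ (2 ^ n) ^ 2 := by
      have : (1 : ℝ) ≤ 2 ^ n := one_le_pow₀ (by norm_num)
      nlinarith
    have h5 : ((2 : ℝ) ^ lev i) ^ 2 < (2 ^ (n + 2)) ^ 2 := by
      rw [pow_add, mul_pow]
      linarith
    have h6 : (2 : ℝ) ^ lev i < 2 ^ (n + 2) := lt_of_pow_lt_pow_left₀ 2 (by positivity) h5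
    have := (pow_lt_pow_iff_right₀ (by norm_num : (1 : ℝ) < 2)).1 h6
    omega
  have hk : ∑ s ∈ Finset.range (n + 3), ((D s).card : ℝ) * 4 ^ s ≤ 16 * n := by
    calc ∑ s ∈ Finset.range (n + 3), ((D s).card : ℝ) * 4 ^ s
        = ∑ s ∈ Finset.range (n + 3), ∑ i ∈ D s, (4 : ℝ) ^ lev i := by
          refine Finset.sum_congr rfl fun s _ => ?_
          rw [Finset.sum_congr rfl fun i hi => by rw [(Finset.mem_filter.1 hi).2]]
          simp
      _ = ∑ i ∈ Z, (4 : ℝ) ^ lev i :=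
          Finset.sum_fiberwise_of_maps_to (fun i hi => Finset.mem_range.2 (hlevN i hi)) _
      _ ≤ ∑ i ∈ Z, (z i : ℝ) ^ 2 := by
          refine Finset.sum_le_sum fun i hi => ?_
          rw [← sq_abs (z i : ℝ), show (4 : ℝ) = 2 ^ 2 by norm_num, ← pow_mul, mul_comm, pow_mul]
          gcongr
          exact hlow i hi
      _ ≤ ∑ i, (z i : ℝ) ^ 2 :=
          Finset.sum_le_sum_of_subset_of_nonneg (Finset.subset_univ _) fun _ _ _ => sq_nonneg _
      _ ≤ _ := hz
  have he0 : ∀ s t, 0 ≤ e s t := fun s t =>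
    Finset.sum_nonneg fun i _ => Finset.sum_nonneg fun j _ => h.nonneg i j
  have hes : ∀ s t, e s t ≤ 2 * a * (D s).card := by
    intro s t
    calc e s t ≤ ∑ i ∈ D s, weightedDegree A' i := by
          refine Finset.sum_le_sum fun i _ => ?_
          exact Finset.sum_le_sum_of_subset_of_nonneg (Finset.subset_univ _)
            fun j _ _ => h.nonneg i j
      _ ≤ ∑ i ∈ D s, 2 * a := Finset.sum_le_sum fun i _ => h.degree_le i
      _ = _ := by rw [Finset.sum_const, nsmul_eq_mul, mul_comm]
  have hesymm : ∀ s t, e s t = e t s := by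
    intro s t
    exact Finset.sum_comm.trans
      (Finset.sum_congr rfl fun i _ => Finset.sum_congr rfl fun j _ => h.symm.apply _ _)
  have het : ∀ s t, e s t ≤ 2 * a * (D t).card := fun s t => hesymm s t ▸ hes t s
  have hdisc : ∀ s < n + 3, ∀ t < n + 3, L ≤ s + t →
      (((s + t - L : ℕ) : ℝ) + 1) * (Real.log 2 / 2) * e s t ≤
        a / n * (D s).card * (D t).card * 2 ^ (s + t - L)
        + (D s).card * (ρ + 4 * s) + (D t).card * (ρ + 4 * t)
        + n * (1 / 8) ^ s + n * (1 / 8) ^ t := by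
    intro s hs t ht hst
    rcases (D s).eq_empty_or_nonempty with h1 | h1
    · have : e s t = 0 := by simp [e, h1]
      rw [this, mul_zero]
      positivity
    rcases (D t).eq_empty_or_nonempty with h2 | h2
    · have : e s t = 0 := by simp [e, h2]
      rw [this, mul_zero]
      positivity
    -- Discrepancy is known for `A` and passes to the entrywise smaller `A'`; the degree bound `hes`
    -- is available for `A'` only.
    refine le_trans ?_ (hA s t (s + t - L) (by omega) (by omega) (by omega) (D s) (D t) h1 h2)
    have hlog : 0 < Real.log 2 := Real.log_pos (by norm_num)
    exact mul_le_mul_of_nonneg_left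
      (Finset.sum_le_sum fun i _ => Finset.sum_le_sum fun j _ => h.le i j) (by positivity)
  have hmain := sum_heavy_levels_le (N := n + 3) (k := fun s => ((D s).card : ℝ)) (e := e)
    hn0 ha hρ hL1 hL2 (fun s => Nat.cast_nonneg _) hk he0 hes het hdisc
  have hpt : ∀ i j, (if |(z i : ℝ) * z j| ≤ 2 * √a then 0 else |(z i : ℝ) * z j|) * A' i j ≤
      if i ∈ Z then (if j ∈ Z then
        4 * (if L ≤ lev i + lev j then 2 ^ (lev i + lev j) * A' i j else 0) else 0) else 0 := by
    intro i j
    have hA' := h.nonneg i j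
    by_cases hi : i ∈ Z
    swap
    · have : z i = 0 := by simpa [Z] using hi
      simp [this, hi]
    by_cases hj : j ∈ Z
    swap
    · have : z j = 0 := by simpa [Z] using hj
      simp [this, hj]
    simp only [hi, hj, if_true]
    have h1 : |(z i : ℝ) * z j| ≤ 2 ^ (lev i + 1) * 2 ^ (lev j + 1) := by
      rw [abs_mul]
      gcongr
      · exact (hup i).le
      · exact (hup j).le
    by_cases hzz : |(z i : ℝ) * z j| ≤ 2 * √a
    · simp only [hzz, if_true, zero_mul]
      split_ifs <;> positivity
    -- Here 2^(L+1) ≤ 2√a < |z_i z_j| ≤ 2^(lev i + lev j + 2). Rounding both factors up to powers of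
    -- two costs the factor 4.
    · have h2 : L ≤ lev i + lev j := by
        have h3 : (2 : ℝ) ^ (L + 1) < 2 ^ (lev i + 1 + (lev j + 1)) := by
          rw [pow_add _ (lev i + 1), pow_succ]
          linarith
        have := (pow_lt_pow_iff_right₀ (by norm_num : (1 : ℝ) < 2)).1 h3
        omega
      simp only [hzz, h2, if_true, if_false]
      rw [← mul_assoc]
      gcongr
      refine h1.trans (le_of_eq ?_)
      ring
  calc _ ≤ _ := Finset.sum_le_sum fun i _ => Finset.sum_le_sum fun j _ => hpt i j
    _ = ∑ i ∈ Z, ∑ j ∈ Z,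
        4 * (if L ≤ lev i + lev j then 2 ^ (lev i + lev j) * A' i j else 0) := by
      exact sum_sum_ite_mem Z _
    _ = 4 * ∑ s ∈ Finset.range (n + 3), ∑ t ∈ Finset.range (n + 3),
        (if L ≤ s + t then 2 ^ (s + t) * e s t else 0) := by
      rw [sum_sum_eq_sum_levels Z lev hlevN
        (fun s t i j => 4 * (if L ≤ s + t then 2 ^ (s + t) * A' i j else 0)), Finset.mul_sum]
      refine Finset.sum_congr rfl fun s _ => ?_
      rw [Finset.mul_sum]
      refine Finset.sum_congr rfl fun t _ => ?_
      split_ifs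
      · simp only [e, D, Finset.mul_sum]
      · simp
    _ ≤ _ := by gcongr

theorem blockMatrix_nonneg {c : Fin n → Bool} {p q : ℝ} (hp : 0 ≤ p) (hq : 0 ≤ q) (i j : Fin n) :
    0 ≤ blockMatrix c p q i j := by
  unfold blockMatrix
  split_ifs <;> assumption

theorem blockMatrix_le {c : Fin n → Bool} {p q : ℝ} (hqp : q ≤ p) (i j : Fin n) :
    blockMatrix c p q i j ≤ p := by
  unfold blockMatrix
  split_ifs
  · exact le_rfl
  · exact hqp

/-- The constant in the bound for the quadratic form of a degree regularization. -/
noncomputable def deviationConstant (ρ : ℝ) : ℝ := 10400 + 1610 * ρ + 80 * Real.exp ρ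

/-- The quadratic form of a degree regularization, compared with that of the block matrix, at
integer vectors. -/
theorem abs_quadratic_form_le {c : Fin n → Bool} {a b ρ : ℝ} {L : ℕ}
    (hn : 1 ≤ n) (hb : 0 ≤ b) (hba : b ≤ a) (ha : 1 ≤ a) (han : a ≤ n) (hρ : 0 ≤ ρ)
    (hL1 : 2 ^ L ≤ √a) (hL2 : √a ≤ 2 ^ (L + 1)) (hA0 : ∀ i j, 0 ≤ A i j)
    (hAs : ∀ i j, A i j = A j i)
    (h1 : HasLightBound A (edgeProbability c (a / n) (b / n)) a ρ)
    (h2 : HasDiscrepancy A a ρ L) (h3 : HasDegreeTail A a ρ)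
    (h : IsDegreeRegularization A (2 * a) A') {z : Fin n → ℤ}
    (hz : ∑ i, (z i : ℝ) ^ 2 ≤ 16 * n) :
    |∑ i, ∑ j, ((z i : ℝ) * z j) * (A' i j - blockMatrix c (a / n) (b / n) i j)| ≤
      deviationConstant ρ * n * √a := by
  set M := blockMatrix c (a / n) (b / n) with hM
  set P := edgeProbability c (a / n) (b / n) with hP
  have hn0 : (0 : ℝ) < n := by exact_mod_cast hn
  have ha0 : 0 < a := by linarith
  have hsa : 0 < √a := Real.sqrt_pos.2 ha0
  have hsa1 : 1 ≤ √a := Real.one_le_sqrt.2 ha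
  have hq : 0 ≤ b / n := by positivity
  have hp : 0 ≤ a / n := by positivity
  have hqp : b / n ≤ a / n := by gcongr
  have hp1 : a / n ≤ 1 := (div_le_one hn0).2 han
  -- `l` keeps the light products; `H` is the absolute value of the heavy ones. The light part is
  -- compared with A - P, while the heavy parts of `A'` and `M` are bounded separately, without
  -- cancellation.
  let l : Fin n → Fin n → ℝ := fun i j =>
    if |(z i : ℝ) * z j| ≤ 2 * √a then (z i : ℝ) * z j else 0
  let H : Fin n → Fin n → ℝ := fun i j =>
    if |(z i : ℝ) * z j| ≤ 2 * √a then 0 else |(z i : ℝ) * z j|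
  have hH0 : ∀ i j, 0 ≤ H i j := by
    intro i j
    simp only [H]
    split_ifs
    · exact le_rfl
    · exact abs_nonneg _
  have hHsq : ∀ i j, H i j ≤ (z i : ℝ) ^ 2 * (z j : ℝ) ^ 2 / (2 * √a) := by
    intro i j
    simp only [H]
    split_ifs with hij
    · positivity
    · rw [le_div_iff₀ (by positivity), ← mul_pow, ← sq_abs ((z i : ℝ) * z j), sq]
      gcongr
      exact (not_le.1 hij).le
  have hl : ∀ i j, |l i j| ≤ 2 * √a := by
    intro i j
    simp only [l]
    split_ifs with hij
    · exact hij
    · simp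
  have hlH : ∀ i j, |(z i : ℝ) * z j - l i j| ≤ H i j := by
    intro i j
    simp only [l, H]
    split_ifs <;> simp
  -- `P` and `M` differ only on the diagonal, by a/n ≤ 1.
  let δ : Fin n → Fin n → ℝ := fun i j => if i = j then (z i : ℝ) ^ 2 else 0
  have hPM : ∀ i j, |l i j * (P i j - M i j)| ≤ δ i j := by
    intro i j
    by_cases hij : i = j
    · subst hij
      have hli : |l i i| ≤ (z i : ℝ) ^ 2 := by
        simp only [l]
        split_ifs
        · rw [sq, abs_mul_self]
        · simpa using sq_nonneg (z i : ℝ)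
      have : P i i - M i i = -(a / n) := by simp [hP, hM, edgeProbability, blockMatrix]
      simp only [δ, if_true, this, abs_mul, abs_neg, abs_of_nonneg hp]
      calc |l i i| * (a / n) ≤ (z i : ℝ) ^ 2 * 1 := by gcongr
        _ = _ := mul_one _
    · have : P i j = M i j := by simp [hP, hM, edgeProbability, blockMatrix, hij]
      simp [this, δ, hij]
  have hpt : ∀ i j, |((z i : ℝ) * z j) * (A' i j - M i j) - l i j * (A i j - P i j)| ≤
      2 * √a * (A i j - A' i j) + δ i j + H i j * A' i j + H i j * M i j := by
    intro i j
    have e1 : ((z i : ℝ) * z j) * (A' i j - M i j) - l i j * (A i j - P i j) =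
        -(l i j * (A i j - A' i j)) + l i j * (P i j - M i j) +
          (((z i : ℝ) * z j - l i j) * A' i j - ((z i : ℝ) * z j - l i j) * M i j) := by ring
    have hA' := h.nonneg i j
    have hM0 : 0 ≤ M i j := blockMatrix_nonneg hp hq i j
    have hAA : 0 ≤ A i j - A' i j := sub_nonneg.2 (h.le i j)
    rw [e1]
    refine (abs_add_le _ _).trans ?_
    refine (add_le_add (abs_add_le _ _) (abs_sub _ _)).trans ?_
    rw [abs_neg, abs_mul, abs_mul _ (A' i j), abs_mul _ (M i j), abs_of_nonneg hAA,
      abs_of_nonneg hA', abs_of_nonneg hM0, ← add_assoc]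
    gcongr
    · exact hl i j
    · exact hPM i j
    · exact hlH i j
    · exact hlH i j
  have hδ : ∑ i, ∑ j, δ i j ≤ 16 * n := by
    simpa [δ] using hz
  have hHA : ∑ i, ∑ j, H i j * A' i j ≤ 4 * ((2500 + 400 * ρ) * n * √a) :=
    h2.sum_heavy_le hn ha0 hρ hL1 hL2 h hz
  have hHM : ∑ i, ∑ j, H i j * M i j ≤ 128 * n * √a := by
    calc ∑ i, ∑ j, H i j * M i j
        ≤ ∑ i, ∑ j, (z i : ℝ) ^ 2 * (z j : ℝ) ^ 2 / (2 * √a) * (a / n) := by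
          refine Finset.sum_le_sum fun i _ => Finset.sum_le_sum fun j _ => ?_
          exact mul_le_mul (hHsq i j) (blockMatrix_le hqp i j) (blockMatrix_nonneg hp hq i j)
            (by positivity)
      _ = (∑ i, (z i : ℝ) ^ 2) * (∑ j, (z j : ℝ) ^ 2) / (2 * √a) * (a / n) := by
          rw [Finset.sum_mul_sum]
          simp only [Finset.sum_div, Finset.sum_mul]
      _ ≤ (16 * n) * (16 * n) / (2 * √a) * (a / n) := by
          have : 0 ≤ ∑ i, (z i : ℝ) ^ 2 := Finset.sum_nonneg fun _ _ => sq_nonneg _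
          gcongr
      _ = 128 * n * √a := by
          have : a = √a * √a := (Real.mul_self_sqrt ha0.le).symm
          field_simp
          linarith
  have hAA := h3.sum_sub_le hA0 hAs h
  have hlight := h1 z hz
  have hdiff : |∑ i, ∑ j, ((z i : ℝ) * z j) * (A' i j - M i j) -
      ∑ i, ∑ j, l i j * (A i j - P i j)| ≤
      2 * √a * (40 * Real.exp ρ * n) + 16 * n + 4 * ((2500 + 400 * ρ) * n * √a) +
        128 * n * √a := by
    rw [← Finset.sum_sub_distrib]
    simp only [← Finset.sum_sub_distrib]
    refine (Finset.abs_sum_le_sum_abs _ _).trans ?_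
    refine (Finset.sum_le_sum fun i _ => (Finset.abs_sum_le_sum_abs _ _).trans
      (Finset.sum_le_sum fun j _ => hpt i j)).trans ?_
    simp only [Finset.sum_add_distrib, ← Finset.mul_sum]
    gcongr
  have htri := abs_add_le (∑ i, ∑ j, ((z i : ℝ) * z j) * (A' i j - M i j) -
      ∑ i, ∑ j, l i j * (A i j - P i j)) (∑ i, ∑ j, l i j * (A i j - P i j))
  rw [sub_add_cancel] at htri
  refine htri.trans ((add_le_add hdiff hlight).trans ?_)
  -- In units of n√a: light pairs 4(60 + ρ), removed weight 80e^ρ, diagonal 16, heavy pairs of `A'`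
  -- 4(2500 + 400ρ), heavy pairs of `M` 128.
  unfold deviationConstant
  have e2 : 16 * (n : ℝ) ≤ 16 * n * √a := le_mul_of_one_le_right (by positivity) hsa1
  have e3 : 0 ≤ n * √a := by positivity
  have e4 : 0 ≤ ρ * (n * √a) := by positivity
  nlinarith

end

/-! ### From integer vectors to the operator norm. -/

/-- Rounding towards zero. -/
theorem exists_int_abs_le (y : ℝ) : ∃ z : ℤ, |(z : ℝ)| ≤ |y| ∧ |y - z| ≤ 1 := by
  rcases le_total 0 y with h | h
  · refine ⟨⌊y⌋, ?_, ?_⟩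
    · rw [abs_of_nonneg h, abs_of_nonneg (by exact_mod_cast Int.floor_nonneg.2 h)]
      exact Int.floor_le y
    · rw [abs_of_nonneg (by linarith [Int.floor_le y])]
      linarith [Int.lt_floor_add_one y]
  · refine ⟨⌈y⌉, ?_, ?_⟩
    · have : (⌈y⌉ : ℝ) ≤ 0 := by
        exact_mod_cast Int.ceil_le.2 (by simpa using h)
      rw [abs_of_nonpos h, abs_of_nonpos this]
      linarith [Int.le_ceil y]
    · rw [abs_of_nonpos (by linarith [Int.le_ceil y])]
      linarith [Int.ceil_lt_add_one y]

/-- A symmetric matrix whose quadratic form is small at the integer vectors in a ball of radius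
`4 * √n` has small operator norm. -/
theorem norm_toEuclideanCLM_le_of_int {n : ℕ} (hn : 1 ≤ n) {B : Matrix (Fin n) (Fin n) ℝ}
    (hB : B.IsSymm) {κ : ℝ} (h : ∀ z : Fin n → ℤ, ∑ i, (z i : ℝ) ^ 2 ≤ 16 * n →
      |∑ i, ∑ j, ((z i : ℝ) * z j) * B i j| ≤ κ * n) :
    ‖Matrix.toEuclideanCLM (𝕜 := ℝ) B‖ ≤ κ / 8 := by
  set T := Matrix.toEuclideanCLM (𝕜 := ℝ) B with hT
  have hn0 : (0 : ℝ) < n := by exact_mod_cast hn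
  have hN : (0 : ℝ) < 4 * √n := by positivity
  have hN2 : (4 * √n) ^ 2 = 16 * (n : ℝ) := by
    rw [mul_pow, Real.sq_sqrt hn0.le]; norm_num
  have hκ : 0 ≤ κ := by
    have := (abs_nonneg _).trans (h 0 (by simp))
    exact nonneg_of_mul_nonneg_left this hn0
  have hsymm : T.IsSymmetric := by
    have := Matrix.isSymmetric_toEuclideanLin_iff (A := B) (𝕜 := ℝ)
    exact this.2 (by
      rw [Matrix.IsHermitian, Matrix.conjTranspose_eq_transpose_of_trivial]
      exact hB)
  have hinner : ∀ x : EuclideanSpace ℝ (Fin n), inner ℝ (T x) x = ∑ i, ∑ j, (x i * x j) * B i j := by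
    intro x
    simp only [PiLp.inner_apply, hT, Matrix.ofLp_toEuclideanCLM, Matrix.mulVec, dotProduct,
      RCLike.inner_apply, conj_trivial, Finset.mul_sum]
    refine Finset.sum_congr rfl fun i _ => Finset.sum_congr rfl fun j _ => ?_
    ring
  have hunit : ∀ x : EuclideanSpace ℝ (Fin n), ‖x‖ = 1 →
      |inner ℝ (T x) x| ≤ κ / 16 + ‖T‖ / 2 := by
    intro x hx
    -- Rounding 4√n·x towards zero stays in the ball, and an error of at most 1 in each of n
    -- coordinates rescales to distance at most 1/4.
    choose z hz1 hz2 using fun i => exists_int_abs_le (4 * √n * x i)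
    have hxs : ∑ i, x i ^ 2 = 1 := by
      have := EuclideanSpace.real_norm_sq_eq x
      rw [hx] at this
      simpa using this.symm
    have hzs : ∑ i, (z i : ℝ) ^ 2 ≤ 16 * n := by
      calc ∑ i, (z i : ℝ) ^ 2 ≤ ∑ i, (4 * √n) ^ 2 * x i ^ 2 := by
            refine Finset.sum_le_sum fun i _ => ?_
            rw [← mul_pow]
            exact sq_le_sq.2 (hz1 i)
        _ = 16 * n := by rw [← Finset.mul_sum, hxs, hN2, mul_one]
    let x' : EuclideanSpace ℝ (Fin n) := WithLp.toLp 2 fun i => (z i : ℝ) / (4 * √n)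
    have hx' : ‖x'‖ ≤ 1 := by
      rw [← sq_le_one_iff₀ (norm_nonneg _), EuclideanSpace.real_norm_sq_eq]
      simp only [x', div_pow, hN2, ← Finset.sum_div]
      exact (div_le_one (by positivity)).2 hzs
    have hd : ‖x - x'‖ ≤ 1 / 4 := by
      refine (pow_le_pow_iff_left₀ (norm_nonneg _) (by norm_num) two_ne_zero).1 ?_
      rw [EuclideanSpace.real_norm_sq_eq]
      calc ∑ i, (x - x') i ^ 2 ≤ ∑ i : Fin n, 1 / (16 * (n : ℝ)) := by
            refine Finset.sum_le_sum fun i _ => ?_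
            have : (x - x') i = (4 * √n * x i - z i) / (4 * √n) := by
              simp [x']
              field_simp
            rw [this, div_pow, hN2]
            gcongr
            rw [← sq_abs]
            exact pow_le_one₀ (abs_nonneg _) (hz2 i)
        _ = (1 / 4) ^ 2 := by
            simp
            field_simp
            norm_num
    have hq : |inner ℝ (T x') x'| ≤ κ / 16 := by
      rw [hinner]
      have : ∑ i, ∑ j, (x' i * x' j) * B i j =
          (∑ i, ∑ j, ((z i : ℝ) * z j) * B i j) / (16 * n) := by
        rw [← hN2]
        simp only [x', Finset.sum_div]
        refine Finset.sum_congr rfl fun i _ => Finset.sum_congr rfl fun j _ => ?_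
        field_simp
      rw [this, abs_div, abs_of_pos (by positivity : (0 : ℝ) < 16 * n), div_le_iff₀ (by positivity)]
      linarith [h z hzs]
    have hsplit : inner ℝ (T x) x = inner ℝ (T x') x' + inner ℝ (T (x - x')) x +
        inner ℝ (T x') (x - x') := by
      simp only [map_sub, inner_sub_left, inner_sub_right]
      ring
    have h1 : |inner ℝ (T (x - x')) x| ≤ ‖T‖ * (1 / 4) * 1 := by
      refine (abs_real_inner_le_norm _ _).trans ?_
      rw [hx]
      gcongr
      exact (T.le_opNorm _).trans (by gcongr)
    have h2 : |inner ℝ (T x') (x - x')| ≤ ‖T‖ * 1 * (1 / 4) := by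
      refine (abs_real_inner_le_norm _ _).trans ?_
      gcongr
      exact (T.le_opNorm _).trans (by gcongr)
    rw [hsplit]
    refine (abs_add_le _ _).trans ((add_le_add (abs_add_le _ _) le_rfl).trans ?_)
    linarith
  -- The norm of a symmetric operator is the supremum of its absolute Rayleigh quotients, so the
  -- bound on unit vectors is self-improving.
  have hle : ‖T‖ ≤ κ / 16 + ‖T‖ / 2 := by
    conv_lhs => rw [T.norm_eq_iSup_rayleighQuotient hsymm]
    refine ciSup_le fun x => ?_
    by_cases hx : x = 0
    · rw [hx, ContinuousLinearMap.rayleighQuotient_apply_zero, abs_zero]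
      positivity
    · have hx0 : ‖x‖ ≠ 0 := norm_ne_zero_iff.2 hx
      rw [← ContinuousLinearMap.rayleigh_smul T x (c := ‖x‖⁻¹) (inv_ne_zero hx0)]
      have hnorm : ‖‖x‖⁻¹ • x‖ = 1 := by
        rw [norm_smul, norm_inv, norm_norm, inv_mul_cancel₀ hx0]
      have := hunit _ hnorm
      rw [ContinuousLinearMap.rayleighQuotient, hnorm, one_pow, div_one]
      simpa [ContinuousLinearMap.reApplyInnerSelf] using this
  linarith

/-! ### The block matrix, community coefficients and residuals. -/

section

variable {n : ℕ} {c : Fin n → Bool}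

theorem IsBalanced.card_filter (hc : IsBalanced c) (τ : Bool) :
    (((Finset.univ.filter fun i => c i = τ).card : ℕ) : ℝ) = n / 2 := by
  have h1 : ∀ σ : Bool, {i | c i = σ}.ncard = (Finset.univ.filter fun i => c i = σ).card := by
    intro σ
    rw [← Set.ncard_coe_finset]
    simp
  have h2 : (Finset.univ.filter fun i => c i = true).card =
      (Finset.univ.filter fun i => c i = false).card := by
    rw [← h1, ← h1]
    exact hc
  have h3 : (Finset.univ.filter fun i => c i = true).card +
      (Finset.univ.filter fun i => c i = false).card = n := by
    have := Finset.card_filter_add_card_filter_not (s := (Finset.univ : Finset (Fin n)))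
      (fun i => c i = true)
    simpa using this
  have h4 : ((Finset.univ.filter fun i => c i = true).card : ℝ) +
      (Finset.univ.filter fun i => c i = false).card = n := by exact_mod_cast h3
  have h5 : ((Finset.univ.filter fun i => c i = true).card : ℝ) =
      (Finset.univ.filter fun i => c i = false).card := by exact_mod_cast h2
  cases τ <;> linarith

/-- The normalized indicator of a community. -/
noncomputable def communityVec (c : Fin n → Bool) (τ : Bool) : EuclideanSpace ℝ (Fin n) :=
  WithLp.toLp 2 fun i => if c i = τ then 1 / √(n / 2) else 0

/-- The coefficient of a vector at the normalized indicator of a community. -/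
noncomputable def communityCoeff (c : Fin n → Bool) (τ : Bool)
    (x : EuclideanSpace ℝ (Fin n)) : ℝ :=
  inner ℝ (communityVec c τ) x

theorem communityCoeff_eq (τ : Bool) (x : EuclideanSpace ℝ (Fin n)) :
    communityCoeff c τ x = (∑ i with c i = τ, x i) / √(n / 2) := by
  simp only [communityCoeff, communityVec, PiLp.inner_apply, RCLike.inner_apply, conj_trivial,
    mul_ite, mul_zero, Finset.sum_filter, Finset.sum_div]
  refine Finset.sum_congr rfl fun i _ => ?_
  split_ifs <;> ring

theorem communityCoeff_nonneg {τ : Bool} {x : EuclideanSpace ℝ (Fin n)} (hx : ∀ i, 0 ≤ x i) :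
    0 ≤ communityCoeff c τ x := by
  rw [communityCoeff_eq]
  exact div_nonneg (Finset.sum_nonneg fun i _ => hx i) (Real.sqrt_nonneg _)

theorem communityCoeff_neg {τ : Bool} {x : EuclideanSpace ℝ (Fin n)} :
    communityCoeff c τ (-x) = -communityCoeff c τ x := by
  simp [communityCoeff, inner_neg_right]

theorem IsBalanced.communityCoeff_self (hc : IsBalanced c) (hn : 0 < n) (τ : Bool) :
    communityCoeff c τ (communityVec c τ) = 1 := by
  have hn0 : (0 : ℝ) < n := by exact_mod_cast hn
  have h2 : √((n : ℝ) / 2) * √(n / 2) = n / 2 := Real.mul_self_sqrt (by positivity)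
  have h3 : √((n : ℝ) / 2) ≠ 0 := (Real.sqrt_pos.2 (by positivity)).ne'
  rw [communityCoeff_eq, Finset.sum_congr rfl fun i hi => by
    simp only [communityVec, (Finset.mem_filter.1 hi).2, if_true]; rfl]
  rw [Finset.sum_const, nsmul_eq_mul, hc.card_filter, mul_one_div, div_div, h2,
    div_self (by positivity)]

theorem communityCoeff_not (τ : Bool) :
    communityCoeff c τ (communityVec c (!τ)) = 0 := by
  rw [communityCoeff_eq, Finset.sum_eq_zero, zero_div]
  intro i hi
  simp [communityVec, (Finset.mem_filter.1 hi).2]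

/-- The bilinear form of the block matrix, in the coefficients at the communities. -/
noncomputable def blockForm (c : Fin n → Bool) (a b : ℝ) (x y : EuclideanSpace ℝ (Fin n)) : ℝ :=
  a / 2 * (communityCoeff c true x * communityCoeff c true y +
      communityCoeff c false x * communityCoeff c false y) +
    b / 2 * (communityCoeff c true x * communityCoeff c false y +
      communityCoeff c false x * communityCoeff c true y)

theorem blockForm_eq (τ : Bool) (a b : ℝ) (x y : EuclideanSpace ℝ (Fin n)) :
    blockForm c a b x y =
      a / 2 * (communityCoeff c τ x * communityCoeff c τ y +
        communityCoeff c (!τ) x * communityCoeff c (!τ) y) +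
      b / 2 * (communityCoeff c τ x * communityCoeff c (!τ) y +
        communityCoeff c (!τ) x * communityCoeff c τ y) := by
  cases τ
  · simp only [blockForm, Bool.not_false]
    ring
  · simp only [blockForm, Bool.not_true]

theorem inner_blockMatrix (hn : 0 < n) (a b : ℝ) (x y : EuclideanSpace ℝ (Fin n)) :
    inner ℝ x (Matrix.toEuclideanCLM (𝕜 := ℝ) (blockMatrix c (a / n) (b / n)) y) =
      blockForm c a b x y := by
  have hn0 : (0 : ℝ) < n := by exact_mod_cast hn
  have h2 : √((n : ℝ) / 2) ^ 2 = n / 2 := Real.sq_sqrt (by positivity)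
  have h3 : √((n : ℝ) / 2) ≠ 0 := (Real.sqrt_pos.2 (by positivity)).ne'
  have h4 : (1 / √((n : ℝ) / 2)) * (1 / √((n : ℝ) / 2)) = 2 / n := by
    rw [← sq, div_pow, h2]; field_simp
  let f : Bool → Fin n → ℝ := fun τ i => if c i = τ then 1 / √((n : ℝ) / 2) else 0
  have hF : ∀ τ z, communityCoeff c τ z = ∑ i, f τ i * z i := by
    intro τ z
    simp only [communityCoeff, communityVec, PiLp.inner_apply, RCLike.inner_apply, conj_trivial, f]
    exact Finset.sum_congr rfl fun i _ => mul_comm _ _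
  have hM : ∀ i j, blockMatrix c (a / n) (b / n) i j =
      a / 2 * (f true i * f true j + f false i * f false j) +
        b / 2 * (f true i * f false j + f false i * f true j) := by
    intro i j
    simp only [blockMatrix, f]
    cases c i <;> cases c j <;> simp only [if_true, if_false, reduceCtorEq, mul_zero, zero_mul,
      add_zero, zero_add, h4] <;>
      field_simp
  rw [Matrix.inner_toEuclideanCLM]
  simp only [blockForm, hF, Finset.sum_mul_sum]
  simp only [← Finset.sum_add_distrib, Finset.mul_sum, Matrix.mulVec, dotProduct, hM]
  refine Finset.sum_congr rfl fun i _ => Finset.sum_congr rfl fun j _ => ?_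
  ring

/-- A symmetric operator with nonnegative entries that is close to the block matrix. -/
structure IsNearBlock (c : Fin n → Bool) (a b β : ℝ)
    (T : EuclideanSpace ℝ (Fin n) →L[ℝ] EuclideanSpace ℝ (Fin n)) : Prop where
  symm : ∀ x y, inner ℝ x (T y) = inner ℝ y (T x)
  nonneg : ∀ x y : EuclideanSpace ℝ (Fin n), (∀ i, 0 ≤ x i) → (∀ i, 0 ≤ y i) → 0 ≤ inner ℝ x (T y)
  abs_sub_le : ∀ x y, |inner ℝ x (T y) - blockForm c a b x y| ≤ β * (‖x‖ * ‖y‖)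

/-- The part of a vector that is orthogonal to the indicators of the communities. -/
noncomputable def communityResidual (c : Fin n → Bool) (x : EuclideanSpace ℝ (Fin n)) :
    EuclideanSpace ℝ (Fin n) :=
  x - communityCoeff c true x • communityVec c true -
    communityCoeff c false x • communityVec c false

theorem IsBalanced.communityCoeff_residual (hc : IsBalanced c) (hn : 0 < n) (τ : Bool)
    (x : EuclideanSpace ℝ (Fin n)) : communityCoeff c τ (communityResidual c x) = 0 := by
  have h1 : ∀ σ, inner ℝ (communityVec c σ) (communityVec c σ) = (1 : ℝ) :=
    hc.communityCoeff_self hn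
  have h2 : ∀ σ, inner ℝ (communityVec c σ) (communityVec c (!σ)) = (0 : ℝ) :=
    communityCoeff_not
  have h3 := h2 true
  have h4 := h2 false
  simp only [Bool.not_true, Bool.not_false] at h3 h4
  cases τ <;> simp only [communityResidual, communityCoeff, inner_sub_right, inner_smul_right, h1,
    h3, h4] <;> ring

theorem IsBalanced.inner_residual (hc : IsBalanced c) (hn : 0 < n)
    (x y : EuclideanSpace ℝ (Fin n)) :
    inner ℝ x y = communityCoeff c true x * communityCoeff c true y +
      communityCoeff c false x * communityCoeff c false y +
      inner ℝ (communityResidual c x) (communityResidual c y) := by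
  have h1 : ∀ τ, inner ℝ (communityVec c τ) (communityResidual c y) = (0 : ℝ) :=
    fun τ => hc.communityCoeff_residual hn τ y
  have h5 : inner ℝ (communityResidual c x) (communityResidual c y) =
      inner ℝ x (communityResidual c y) := by
    conv_lhs => rw [communityResidual]
    simp [inner_sub_left, inner_smul_left, h1]
  rw [h5, communityResidual]
  simp only [inner_sub_right, inner_smul_right, communityCoeff]
  rw [real_inner_comm x (communityVec c true), real_inner_comm x (communityVec c false)]
  ring

theorem IsBalanced.norm_sq_eq (hc : IsBalanced c) (hn : 0 < n) (x : EuclideanSpace ℝ (Fin n)) :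
    ‖x‖ ^ 2 = communityCoeff c true x ^ 2 + communityCoeff c false x ^ 2 +
      ‖communityResidual c x‖ ^ 2 := by
  rw [← real_inner_self_eq_norm_sq, hc.inner_residual hn, real_inner_self_eq_norm_sq]
  ring

/-- Test the eigenvector equation against the residual w: the block form vanishes there, so λ‖w‖² is
pure error, at most β‖w‖. -/
theorem IsNearBlock.norm_residual_le {a b β lam : ℝ}
    {T : EuclideanSpace ℝ (Fin n) →L[ℝ] EuclideanSpace ℝ (Fin n)} (hT : IsNearBlock c a b β T)
    (hc : IsBalanced c) (hn : 0 < n) {x : EuclideanSpace ℝ (Fin n)} (hx : ‖x‖ = 1)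
    (hTx : T x = lam • x) : lam * ‖communityResidual c x‖ ≤ β := by
  set w := communityResidual c x
  have h1 : inner ℝ w (T x) = lam * ‖w‖ ^ 2 := by
    rw [hTx, inner_smul_right, hc.inner_residual hn w x, hc.communityCoeff_residual hn,
      hc.communityCoeff_residual hn]
    have : communityResidual c w = w := by
      conv_lhs => rw [communityResidual]
      simp [w, hc.communityCoeff_residual hn]
    rw [this, zero_mul, zero_mul, real_inner_self_eq_norm_sq]
    ring
  have h2 : blockForm c a b w x = 0 := by
    simp [blockForm, w, hc.communityCoeff_residual hn]
  have h3 := (abs_le.1 (hT.abs_sub_le w x)).2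
  rw [h1, h2, hx, mul_one, sub_zero] at h3
  rcases (norm_nonneg w).eq_or_lt with h | h
  · have h4 := (abs_nonneg _).trans (hT.abs_sub_le x x)
    rw [hx] at h4
    rw [← h]
    linarith
  · have : lam * ‖w‖ * ‖w‖ ≤ β * ‖w‖ := by linarith
    exact le_of_mul_le_mul_right this h

theorem communityResidual_apply {τ : Bool} {i : Fin n} (hi : c i = τ)
    (x : EuclideanSpace ℝ (Fin n)) :
    communityResidual c x i = x i - communityCoeff c τ x / √(n / 2) := by
  subst hi
  cases h : c i <;> simp [communityResidual, communityVec, h, div_eq_mul_inv]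

/-- Few entries of a vector have a sign that disagrees with its mean over the community. -/
theorem card_wrong_sign_mul_le (hn : 0 < n) (τ : Bool) (x : EuclideanSpace ℝ (Fin n)) :
    ((Finset.univ.filter fun i => c i = τ ∧ x i * communityCoeff c τ x ≤ 0).card : ℝ) *
      communityCoeff c τ x ^ 2 ≤ n / 2 * ‖communityResidual c x‖ ^ 2 := by
  have hn0 : (0 : ℝ) < n := by exact_mod_cast hn
  have h2 : √((n : ℝ) / 2) ^ 2 = n / 2 := Real.sq_sqrt (by positivity)
  have h3 : 0 < √((n : ℝ) / 2) := Real.sqrt_pos.2 (by positivity)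
  set y := communityCoeff c τ x
  have h1 : ((Finset.univ.filter fun i => c i = τ ∧ x i * y ≤ 0).card : ℝ) *
      (y ^ 2 / (n / 2)) ≤ ‖communityResidual c x‖ ^ 2 := by
    rw [EuclideanSpace.real_norm_sq_eq, ← nsmul_eq_mul, ← Finset.sum_const]
    refine (Finset.sum_le_sum fun i hi => ?_).trans
      (Finset.sum_le_sum_of_subset_of_nonneg (Finset.filter_subset _ _) fun _ _ _ => sq_nonneg _)
    obtain ⟨hci, hxi⟩ := (Finset.mem_filter.1 hi).2
    have h4 : y ^ 2 / (n / 2) = (y / √(n / 2)) ^ 2 := by rw [div_pow, h2]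
    rw [communityResidual_apply hci, h4]
    -- On a vertex of the wrong sign the residual entry is x i minus a number of opposite sign (or
    -- 0), so its square is at least the square of that number.
    have : x i * (y / √(n / 2)) ≤ 0 := by
      rw [← mul_div_assoc]
      exact div_nonpos_of_nonpos_of_nonneg hxi h3.le
    nlinarith [sq_nonneg (x i)]
  rw [← mul_div_assoc, div_le_iff₀ (by positivity)] at h1
  linarith

end

/-! ### Negative parts of an eigenvector on the communities. -/

section

variable {n : ℕ} {c : Fin n → Bool}

theorem signsRecover_of_card {v : Fin n → ℝ} {ε : ℝ} (τ : Bool) {α α' : SignType} (hα : α ≠ α')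
    (h1 : ((Finset.univ.filter fun i => c i = τ ∧ SignType.sign (v i) ≠ α).card : ℝ) ≤ ε / 2 * n)
    (h2 : ((Finset.univ.filter fun i => c i = (!τ) ∧ SignType.sign (v i) ≠ α').card : ℝ) ≤
      ε / 2 * n) :
    SignsRecover c v (ε * n) := by
  classical
  have key : ∀ f : Fin n → SignType, (∀ i, c i = τ → f i = α) → (∀ i, c i = (!τ) → f i = α') →
      ({i | SignType.sign (v i) ≠ f i}.ncard : ℝ) ≤ ε * n := by
    intro f hf1 hf2
    have hsub : {i | SignType.sign (v i) ≠ f i} ⊆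
        ((Finset.univ.filter fun i => c i = τ ∧ SignType.sign (v i) ≠ α) ∪
          (Finset.univ.filter fun i => c i = (!τ) ∧ SignType.sign (v i) ≠ α') :
            Finset (Fin n)) := by
      intro i hi
      simp only [Set.mem_ofPred_eq] at hi
      simp only [Finset.coe_union, Finset.coe_filter, Finset.mem_univ, true_and, Set.mem_union,
        Set.mem_ofPred_eq]
      by_cases h : c i = τ
      · left; exact ⟨h, hf1 i h ▸ hi⟩
      · right
        have h' : c i = !τ := by revert h; cases c i <;> cases τ <;> simp
        exact ⟨h', hf2 i h' ▸ hi⟩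
    have h3 := (Set.ncard_le_ncard hsub (Finset.finite_toSet _)).trans
      ((Set.ncard_coe_finset _).trans_le (Finset.card_union_le _ _))
    have h4 : ({i | SignType.sign (v i) ≠ f i}.ncard : ℝ) ≤
        ((Finset.univ.filter fun i => c i = τ ∧ SignType.sign (v i) ≠ α).card : ℝ) +
        ((Finset.univ.filter fun i => c i = (!τ) ∧ SignType.sign (v i) ≠ α').card : ℝ) := by
      exact_mod_cast h3
    linarith
  cases τ
  · exact ⟨α', α, hα.symm, key _ (fun i hi => by simp [hi]) fun i hi => by simp_all⟩
  · exact ⟨α, α', hα, key _ (fun i hi => by simp [hi]) fun i hi => by simp_all⟩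

theorem SignsRecover.of_neg {v : Fin n → ℝ} {m : ℝ} (h : SignsRecover c (-v) m) :
    SignsRecover c v m := by
  obtain ⟨α, β, hαβ, hle⟩ := h
  refine ⟨-α, -β, fun h => hαβ (neg_injective h), ?_⟩
  convert hle using 3
  ext i
  simp only [Set.mem_ofPred_eq, Pi.neg_apply, Left.sign_neg]
  split_ifs <;> exact not_congr ⟨fun h => by rw [h, neg_neg], fun h => by rw [← h, neg_neg]⟩

/-- The negative part of a vector on one community. -/
noncomputable def communityNegPart (c : Fin n → Bool) (τ : Bool) (v : EuclideanSpace ℝ (Fin n)) :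
    EuclideanSpace ℝ (Fin n) :=
  WithLp.toLp 2 fun i => if c i = τ then max (-v i) 0 else 0

theorem communityNegPart_nonneg (τ : Bool) (v : EuclideanSpace ℝ (Fin n)) (i : Fin n) :
    0 ≤ communityNegPart c τ v i := by
  simp only [communityNegPart]
  split_ifs <;> simp

theorem communityCoeff_negPart_not (τ : Bool) (v : EuclideanSpace ℝ (Fin n)) :
    communityCoeff c (!τ) (communityNegPart c τ v) = 0 := by
  rw [communityCoeff_eq, Finset.sum_eq_zero, zero_div]
  intro i hi
  simp [communityNegPart, (Finset.mem_filter.1 hi).2]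

/-- Cauchy–Schwarz on the support of the negative part. -/
theorem communityCoeff_negPart_sq_le (hn : 0 < n) (τ : Bool) (v : EuclideanSpace ℝ (Fin n)) {θ : ℝ}
    (hθ : ((Finset.univ.filter fun i => c i = τ ∧ v i < 0).card : ℝ) ≤ θ * (n / 2)) :
    communityCoeff c τ (communityNegPart c τ v) ^ 2 ≤ θ * ‖communityNegPart c τ v‖ ^ 2 := by
  have hn0 : (0 : ℝ) < n := by exact_mod_cast hn
  set q := communityNegPart c τ v with hq
  have h1 : ∑ i with c i = τ, q i = ∑ i with c i = τ ∧ v i < 0, q i := by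
    symm
    apply Finset.sum_subset
    · intro i hi
      exact Finset.mem_filter.2 ⟨Finset.mem_univ _, (Finset.mem_filter.1 hi).2.1⟩
    · intro i hi hi'
      have h2 := (Finset.mem_filter.1 hi).2
      have h3 : 0 ≤ v i := by
        by_contra h
        exact hi' (Finset.mem_filter.2 ⟨Finset.mem_univ _, h2, not_le.1 h⟩)
      simp [hq, communityNegPart, h3]
  rw [communityCoeff_eq, div_pow, Real.sq_sqrt (by positivity), div_le_iff₀ (by positivity), h1]
  calc _ ≤ ((Finset.univ.filter fun i => c i = τ ∧ v i < 0).card : ℝ) *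
        ∑ i with c i = τ ∧ v i < 0, q i ^ 2 := sq_sum_le_card_mul_sum_sq
    _ ≤ θ * (n / 2) * ‖q‖ ^ 2 := by
        rw [EuclideanSpace.real_norm_sq_eq]
        refine mul_le_mul hθ (Finset.sum_le_sum_of_subset_of_nonneg (Finset.filter_subset _ _)
          fun _ _ _ => sq_nonneg _) (Finset.sum_nonneg fun _ _ => sq_nonneg _)
          ((Nat.cast_nonneg _).trans hθ)
    _ = _ := by ring

theorem IsBalanced.abs_communityCoeff_le (hc : IsBalanced c) (hn : 0 < n) (τ : Bool)
    (x : EuclideanSpace ℝ (Fin n)) : |communityCoeff c τ x| ≤ ‖x‖ := by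
  refine abs_le_of_sq_le_sq ?_ (norm_nonneg _)
  rw [hc.norm_sq_eq hn]
  cases τ <;> nlinarith [sq_nonneg (communityCoeff c true x), sq_nonneg (communityCoeff c false x),
    sq_nonneg ‖communityResidual c x‖]

/-- The equation of an eigenvector, tested against its negative part on a community. -/
theorem IsNearBlock.negPart_le {a b β lam : ℝ}
    {T : EuclideanSpace ℝ (Fin n) →L[ℝ] EuclideanSpace ℝ (Fin n)} (hT : IsNearBlock c a b β T)
    (τ : Bool) {v : EuclideanSpace ℝ (Fin n)} (hv : T v = lam • v) :
    lam * ‖communityNegPart c τ v‖ ^ 2 -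
        inner ℝ (communityNegPart c τ v) (T (communityNegPart c τ v)) ≤
      inner ℝ (communityNegPart c τ v) (T (communityNegPart c (!τ) v)) := by
  set q := communityNegPart c τ v with hq
  set h := communityNegPart c (!τ) v with hh
  -- The positive part `p` is taken over all vertices. Its interaction with the negative part `q` is
  -- nonnegative since the operator has nonnegative entries, so it can be dropped.
  let p : EuclideanSpace ℝ (Fin n) := WithLp.toLp 2 fun i => max (v i) 0
  have hdec : v = p - q - h := by
    ext i
    have hmax : max (v i) 0 - max (-v i) 0 = v i := by
      rcases le_total 0 (v i) with h0 | h0 <;> simp [h0]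
    have : c i = τ ∨ c i = !τ := by cases c i <;> cases τ <;> simp
    rcases this with h0 | h0 <;> simp [p, hq, hh, communityNegPart, h0, hmax]
  have hqv : inner ℝ q v = -‖q‖ ^ 2 := by
    rw [EuclideanSpace.real_norm_sq_eq, ← Finset.sum_neg_distrib]
    simp only [PiLp.inner_apply, RCLike.inner_apply, conj_trivial]
    refine Finset.sum_congr rfl fun i _ => ?_
    simp only [hq, communityNegPart]
    split_ifs
    · rcases le_total 0 (v i) with h0 | h0
      · simp [h0]
      · simp [h0]; ring
    · simp
  have hpos : 0 ≤ inner ℝ q (T p) :=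
    hT.nonneg q p (communityNegPart_nonneg τ v) fun i => by simp [p]
  have h1 : inner ℝ q (T v) = lam * -‖q‖ ^ 2 := by rw [hv, inner_smul_right, hqv]
  have h2 : inner ℝ q (T v) = inner ℝ q (T p) - inner ℝ q (T q) - inner ℝ q (T h) := by
    conv_lhs => rw [hdec]
    simp only [map_sub, inner_sub_right]
  linarith

/-- If v is negative on only a fraction θ of the community, Cauchy–Schwarz limits the
self-interaction of the negative part to aθ/2 + β, below λ when θ is away from 1 and b, β are small.
What remains is the interaction across communities, of size b/2 + β. -/
theorem IsNearBlock.negPart_sq_le {a b β lam θ : ℝ}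
    {T : EuclideanSpace ℝ (Fin n) →L[ℝ] EuclideanSpace ℝ (Fin n)} (hT : IsNearBlock c a b β T)
    (hc : IsBalanced c) (hn : 0 < n) (ha : 0 ≤ a) (hb : 0 ≤ b)
    (τ : Bool) {v : EuclideanSpace ℝ (Fin n)} (hv : T v = lam • v)
    (hθ : ((Finset.univ.filter fun i => c i = τ ∧ v i < 0).card : ℝ) ≤ θ * (n / 2)) :
    (lam - a / 2 * θ - β) * ‖communityNegPart c τ v‖ ^ 2 ≤
      (b / 2 + β) * (‖communityNegPart c τ v‖ * ‖communityNegPart c (!τ) v‖) := by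
  have h1 := hT.negPart_le τ hv
  have h2 := communityCoeff_negPart_sq_le hn τ v hθ
  have h3 := communityCoeff_negPart_not (c := c) τ v
  have h4 := communityCoeff_negPart_not (c := c) (!τ) v
  rw [Bool.not_not] at h4
  set q := communityNegPart c τ v
  set h := communityNegPart c (!τ) v
  have h5 := (abs_le.1 (hT.abs_sub_le q q)).2
  have h6 := (abs_le.1 (hT.abs_sub_le q h)).2
  rw [blockForm_eq τ] at h5 h6
  rw [h3] at h5 h6
  rw [h4] at h6
  have h7 : communityCoeff c τ q * communityCoeff c (!τ) h ≤ ‖q‖ * ‖h‖ := by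
    refine (le_abs_self _).trans ?_
    rw [abs_mul]
    exact mul_le_mul (hc.abs_communityCoeff_le hn τ q) (hc.abs_communityCoeff_le hn (!τ) h)
      (abs_nonneg _) (norm_nonneg _)
  nlinarith [mul_le_mul_of_nonneg_left h2 ha, mul_le_mul_of_nonneg_left h7 hb]

end

/-! ### Recovery of the communities from the signs of an eigenvector. -/

section

variable {n : ℕ} {c : Fin n → Bool}

theorem card_wrong_sign_le (hn : 0 < n) (τ : Bool) {x : EuclideanSpace ℝ (Fin n)} {y r θ : ℝ}
    (hy : 0 < y) (hx : y ≤ communityCoeff c τ x ^ 2) (hr : ‖communityResidual c x‖ ≤ r)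
    (hθ : r ^ 2 ≤ θ * y) :
    ((Finset.univ.filter fun i => c i = τ ∧ x i * communityCoeff c τ x ≤ 0).card : ℝ) ≤
      θ * (n / 2) := by
  have h := card_wrong_sign_mul_le (c := c) hn τ x
  set N : ℝ := ((Finset.univ.filter fun i => c i = τ ∧ x i * communityCoeff c τ x ≤ 0).card : ℝ)
  have hn0 : (0 : ℝ) < n := by exact_mod_cast hn
  have h1 : N * y ≤ N * communityCoeff c τ x ^ 2 :=
    mul_le_mul_of_nonneg_left hx (Nat.cast_nonneg _)
  have h2 : (n : ℝ) / 2 * ‖communityResidual c x‖ ^ 2 ≤ n / 2 * r ^ 2 := by gcongr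
  have h3 : (n : ℝ) / 2 * r ^ 2 ≤ n / 2 * (θ * y) := by gcongr
  have h4 : N * y ≤ θ * (n / 2) * y := by linarith
  exact le_of_mul_le_mul_right h4 hy

/-- Coefficients of two orthogonal unit vectors, the first of which is nonnegative, when the second
has a small coefficient `x`. -/
theorem coeff_bounds_of_small {δ s t x y ru rv w : ℝ} (hδ : δ ≤ 1 / 8100) (hs0 : 0 ≤ s)
    (ht0 : 0 ≤ t) (hnu : 1 = s ^ 2 + t ^ 2 + ru ^ 2) (hnv : 1 = x ^ 2 + y ^ 2 + rv ^ 2)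
    (hru : ru ^ 2 ≤ δ) (hrv : rv ^ 2 ≤ δ) (hw : -δ ≤ w) (hsum : s * x + t * y = -w)
    (hx : |x| < 1 / 4) (hy : 0 ≤ y) : 7 / 8 ≤ y ^ 2 ∧ t ≤ 3 / 10 ∧ 9 / 10 ≤ s := by
  obtain ⟨hx1, hx2⟩ := abs_lt.1 hx
  have hx3 : x ^ 2 ≤ 1 / 16 := by nlinarith only [hx1, hx2]
  have hy2 : 7 / 8 ≤ y ^ 2 := by linarith
  have hy3 : 9 / 10 ≤ y := by
    refine (pow_le_pow_iff_left₀ (by norm_num) hy two_ne_zero).1 ?_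
    linarith
  have hs1 : s ≤ 1 := by
    refine (pow_le_pow_iff_left₀ hs0 zero_le_one two_ne_zero).1 ?_
    linarith [sq_nonneg t, sq_nonneg ru]
  have htle : t ≤ 3 / 10 := by
    have h0 : s * -(1 / 4) ≤ s * x := mul_le_mul_of_nonneg_left hx1.le hs0
    have h1 : t * y ≤ 1 / 4 + 1 / 8100 := by linarith
    have h2 : t * (9 / 10) ≤ t * y := mul_le_mul_of_nonneg_left hy3 ht0
    linarith
  refine ⟨hy2, htle, ?_⟩
  have ht2 : t ^ 2 ≤ (3 / 10) ^ 2 := by gcongr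
  refine (pow_le_pow_iff_left₀ (by norm_num) hs0 two_ne_zero).1 ?_
  linarith

/-- If a leading eigenvector is concentrated on one community, then the density of edges between
the communities is small. -/
theorem IsNearBlock.cross_density_le {a b β lam₁ : ℝ} (hc : IsBalanced c) (hn : 0 < n)
    {T : EuclideanSpace ℝ (Fin n) →L[ℝ] EuclideanSpace ℝ (Fin n)} (hT : IsNearBlock c a b β T)
    (ha : 0 ≤ a) (hb : 0 ≤ b) (hβ0 : 0 ≤ β)
    {u : EuclideanSpace ℝ (Fin n)} (hu : ‖u‖ = 1) (hTu : T u = lam₁ • u) (τ : Bool)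
    (ht0 : 0 ≤ communityCoeff c (!τ) u) (ht : communityCoeff c (!τ) u ≤ 3 / 10)
    (hs : 9 / 10 ≤ communityCoeff c τ u) : b ≤ 8 * β := by
  have hnu := hc.norm_sq_eq hn u
  have hfu := (abs_le.1 (hT.abs_sub_le (communityVec c (!τ)) u)).1
  have hfn : ‖communityVec c (!τ)‖ = 1 := by
    have := hc.communityCoeff_self hn (!τ)
    rw [communityCoeff, real_inner_self_eq_norm_sq] at this
    exact (pow_eq_one_iff_of_nonneg (norm_nonneg _) two_ne_zero).1 this
  have hff : communityCoeff c τ (communityVec c (!τ)) = 0 := communityCoeff_not τ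
  rw [hfn, hu, hTu, inner_smul_right, blockForm_eq τ, hff, hc.communityCoeff_self hn] at hfu
  change _ ≤ lam₁ * communityCoeff c (!τ) u - _ at hfu
  have huu := (abs_le.1 (hT.abs_sub_le u u)).2
  rw [hTu, inner_smul_right, real_inner_self_eq_norm_sq, hu, blockForm_eq τ] at huu
  rw [hu] at hnu
  have h1 : communityCoeff c τ u ^ 2 + communityCoeff c (!τ) u ^ 2 ≤ 1 := by
    cases τ <;> simp only [Bool.not_true, Bool.not_false] <;>
      linarith [sq_nonneg ‖communityResidual c u‖]
  clear hff hfn hnu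
  generalize communityCoeff c τ u = s at *
  generalize communityCoeff c (!τ) u = t at *
  -- The Rayleigh quotient of u gives λ₁ ≤ (a + b)/2 + β, and its equation tested on the other
  -- community gives λ₁t ≥ (at + bs)/2 - β. Together b(s - t)/2 ≤ β(1 + t), where s - t ≥ 3/5.
  have h1' : a * (s ^ 2 + t ^ 2) ≤ a * 1 := mul_le_mul_of_nonneg_left h1 ha
  have h2 : b * (s * t * 2) ≤ b * 1 :=
    mul_le_mul_of_nonneg_left (by linarith [sq_nonneg (s - t), sub_sq s t]) hb
  have h3 : lam₁ ≤ a / 2 + b / 2 + β := by linarith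
  have h4 : lam₁ * t ≤ (a / 2 + b / 2 + β) * t := mul_le_mul_of_nonneg_right h3 ht0
  have h5 : β * t ≤ β * (3 / 10) := mul_le_mul_of_nonneg_left ht hβ0
  have h6 : b * (9 / 10) ≤ b * s := mul_le_mul_of_nonneg_left hs hb
  have h7 : b * t ≤ b * (3 / 10) := mul_le_mul_of_nonneg_left ht hb
  linarith

/-- X and Y stand for the norms of the negative parts on the two communities. The cross coefficient
b/2 + β ≤ 5β ≤ εa/40 is so small against the diagonal ones that 16X² ≤ XY and 8Y² ≤ XY, which leaves
only zero. -/
theorem eq_zero_of_mutual_bounds {a b β ε lam X Y : ℝ} (hε : 0 < ε) (hε1 : ε ≤ 1) (ha0 : 0 < a)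
    (hbβ : b ≤ 8 * β) (hβ : β ≤ ε / 200 * a) (hlam : (a - b) / 2 - β ≤ lam)
    (hX0 : 0 ≤ X) (hY0 : 0 ≤ Y)
    (q1 : (lam - a / 2 * (1 - ε) - β) * X ^ 2 ≤ (b / 2 + β) * (X * Y))
    (q2 : (lam - a / 2 * (1 / 2) - β) * Y ^ 2 ≤ (b / 2 + β) * (Y * X)) : X = 0 ∧ Y = 0 := by
  have hεa : 0 < ε * a := by positivity
  have hεa' : ε * a ≤ a := mul_le_of_le_one_left ha0.le hε1
  have hXY : 0 ≤ X * Y := mul_nonneg hX0 hY0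
  have c1 : 2 / 5 * (ε * a) ≤ lam - a / 2 * (1 - ε) - β := by linarith
  have c2 : 1 / 5 * a ≤ lam - a / 2 * (1 / 2) - β := by linarith
  have c3 : b / 2 + β ≤ 1 / 40 * (ε * a) := by linarith
  have c4 : b / 2 + β ≤ 1 / 40 * a := by linarith
  have d1 : 2 / 5 * (ε * a) * X ^ 2 ≤ 1 / 40 * (ε * a) * (X * Y) :=
    (mul_le_mul_of_nonneg_right c1 (sq_nonneg X)).trans
      (q1.trans (mul_le_mul_of_nonneg_right c3 hXY))
  have d2 : 1 / 5 * a * Y ^ 2 ≤ 1 / 40 * a * (X * Y) := by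
    rw [mul_comm Y X] at q2
    exact (mul_le_mul_of_nonneg_right c2 (sq_nonneg Y)).trans
      (q2.trans (mul_le_mul_of_nonneg_right c4 hXY))
  have d3 : 16 * X ^ 2 ≤ X * Y := by
    refine le_of_mul_le_mul_left ?_ hεa
    linarith
  have d4 : 8 * Y ^ 2 ≤ X * Y := by
    refine le_of_mul_le_mul_left ?_ ha0
    linarith
  have d5 : X ^ 2 + Y ^ 2 ≤ 0 := by linarith [sq_nonneg (X - Y), sub_sq X Y]
  exact ⟨pow_eq_zero_iff two_ne_zero |>.1 (le_antisymm (by linarith [sq_nonneg Y]) (sq_nonneg X)),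
    pow_eq_zero_iff two_ne_zero |>.1 (le_antisymm (by linarith [sq_nonneg X]) (sq_nonneg Y))⟩

/-- A second eigenvector with a small mean on the community `τ` is of constant sign on most of
that community. -/
theorem signsRecover_of_small_coeff (hc : IsBalanced c) (hn : 0 < n) {a b β ε lam lam₁ : ℝ}
    (hε : 0 < ε) (hε1 : ε ≤ 1) (hb : 0 ≤ b) (hba : b < a) (hβ0 : 0 ≤ β)
    (hβ : β ≤ ε / 200 * (a - b))
    {T : EuclideanSpace ℝ (Fin n) →L[ℝ] EuclideanSpace ℝ (Fin n)} (hT : IsNearBlock c a b β T)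
    {u v : EuclideanSpace ℝ (Fin n)} (hu : ‖u‖ = 1) (hv : ‖v‖ = 1) (hTv : T v = lam • v)
    (hTu : T u = lam₁ • u) (hu0 : ∀ i, 0 ≤ u i) (huv : inner ℝ u v = (0 : ℝ))
    (hlam : (a - b) / 2 - β ≤ lam)
    (hru : ‖communityResidual c u‖ ≤ ε / 90) (hrv : ‖communityResidual c v‖ ≤ ε / 90)
    (τ : Bool) (hτ : |communityCoeff c τ v| < 1 / 4) (hτ' : 0 ≤ communityCoeff c (!τ) v) :
    SignsRecover c v (ε * n) := by
  have hn0 : (0 : ℝ) < n := by exact_mod_cast hn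
  have hnorm : ∀ x : EuclideanSpace ℝ (Fin n), ‖x‖ ^ 2 = communityCoeff c τ x ^ 2 +
      communityCoeff c (!τ) x ^ 2 + ‖communityResidual c x‖ ^ 2 := by
    intro x
    rw [hc.norm_sq_eq hn]
    cases τ <;> simp only [Bool.not_true, Bool.not_false]
    ring
  have hinner := hc.inner_residual hn u v
  have hres : |inner ℝ (communityResidual c u) (communityResidual c v)| ≤ ε / 90 * (ε / 90) :=
    (abs_real_inner_le_norm _ _).trans (mul_le_mul hru hrv (norm_nonneg _) (by positivity))
  have hsum : communityCoeff c τ u * communityCoeff c τ v +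
      communityCoeff c (!τ) u * communityCoeff c (!τ) v =
      -inner ℝ (communityResidual c u) (communityResidual c v) := by
    rw [huv] at hinner
    cases τ <;> simp only [Bool.not_true, Bool.not_false] <;> linarith
  have hnu := hnorm u
  have hnv := hnorm v
  have hru2 : ‖communityResidual c u‖ ^ 2 ≤ (ε / 90) ^ 2 := by gcongr
  have hrv2 : ‖communityResidual c v‖ ^ 2 ≤ (ε / 90) ^ 2 := by gcongr
  have hε2 : (ε / 90) ^ 2 ≤ ε / 8100 := by nlinarith
  have hε3 : (ε / 90) ^ 2 ≤ 1 / 8100 := by linarith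
  rw [hu, one_pow] at hnu
  rw [hv, one_pow] at hnv
  have hs0 : 0 ≤ communityCoeff c τ u := communityCoeff_nonneg hu0
  have ht0 : 0 ≤ communityCoeff c (!τ) u := communityCoeff_nonneg hu0
  -- A small coefficient of v on τ puts most of v on the other community; orthogonality then drives
  -- u onto τ.
  obtain ⟨hy2, ht, hs⟩ := coeff_bounds_of_small hε3 hs0 ht0 hnu hnv hru2 hrv2 (by rw [sq]; exact (abs_le.1 hres).1) hsum hτ hτ'
  have hbβ := hT.cross_density_le hc hn (hb.trans hba.le) hb hβ0 hu hTu τ ht0 ht hs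
  set y := communityCoeff c (!τ) v
  have hy0 : 0 < y := hτ'.lt_of_ne fun h => by rw [← h] at hy2; norm_num at hy2
  have hβa : β ≤ ε / 200 * a := hβ.trans (by gcongr; linarith)
  have hcard2 : ((Finset.univ.filter fun i => c i = (!τ) ∧ v i * y ≤ 0).card : ℝ) ≤
      ε * (n / 2) :=
    card_wrong_sign_le hn (!τ) (y := 7 / 8) (by norm_num) hy2 hrv (by linarith)
  have hcard2' : ((Finset.univ.filter fun i => c i = (!τ) ∧ v i * y ≤ 0).card : ℝ) ≤
      1 / 2 * (n / 2) :=
    card_wrong_sign_le hn (!τ) (y := 7 / 8) (by norm_num) hy2 hrv (by linarith)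
  have hneg : ((Finset.univ.filter fun i => c i = (!τ) ∧ v i < 0).card : ℝ) ≤
      1 / 2 * (n / 2) := by
    refine le_trans ?_ hcard2'
    gcongr with i
    intro h
    exact mul_nonpos_of_nonpos_of_nonneg h.le hτ'
  have hpos2 : ((Finset.univ.filter fun i => c i = (!τ) ∧ SignType.sign (v i) ≠ 1).card : ℝ) ≤
      ε / 2 * n := by
    refine le_trans ?_ (hcard2.trans (le_of_eq (by ring)))
    gcongr with i
    intro h
    have h0 : ¬ 0 < v i := fun h0 => h (sign_pos h0)
    exact mul_nonpos_of_nonpos_of_nonneg (not_lt.1 h0) hτ'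
  -- Either v is negative on most of τ, giving the signs - and +, or its nonnegative entries occupy
  -- more than a fraction ε of τ. In the latter case θ = 1 - ε on τ and θ = 1/2 on the other
  -- community make both negative parts vanish, and the signs are 0 and +.
  by_cases hS : ((Finset.univ.filter fun i => c i = τ ∧ 0 ≤ v i).card : ℝ) ≤ ε / 2 * n
  · refine signsRecover_of_card τ (α := -1) (α' := 1) (by decide) (le_trans ?_ hS) hpos2
    gcongr with i
    intro h
    by_contra h0
    exact h (sign_neg (not_le.1 h0))
  · have hcard1 : ((Finset.univ.filter fun i => c i = τ ∧ v i < 0).card : ℝ) ≤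
        (1 - ε) * (n / 2) := by
      have h1 := Finset.card_filter_add_card_filter_not
        (s := (Finset.univ.filter fun i => c i = τ)) (fun i => 0 ≤ v i)
      rw [Finset.filter_filter, Finset.filter_filter] at h1
      simp only [not_le] at h1
      have h2 := hc.card_filter τ
      rw [← h1] at h2
      push_cast at h2
      linarith
    have q1 := hT.negPart_sq_le hc hn (hb.trans hba.le) hb τ hTv hcard1
    have q2 := hT.negPart_sq_le hc hn (hb.trans hba.le) hb (!τ) hTv hneg
    rw [Bool.not_not] at q2
    obtain ⟨hX, hY⟩ := eq_zero_of_mutual_bounds hε hε1 (hb.trans_lt hba) hbβ hβa hlam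
      (norm_nonneg _) (norm_nonneg _) q1 q2
    have hq : ∀ σ, communityNegPart c σ v = 0 := by
      intro σ
      by_cases h : σ = τ
      · rw [h]; exact norm_eq_zero.1 hX
      · have : σ = !τ := by revert h; cases σ <;> cases τ <;> simp
        rw [this]; exact norm_eq_zero.1 hY
    have hv0 : ∀ i, 0 ≤ v i := by
      intro i
      have h1 : communityNegPart c (c i) v i = 0 := by rw [hq]; rfl
      simp only [communityNegPart, if_true] at h1
      linarith [le_max_left (-v i) 0]
    -- Orthogonal nonnegative vectors have disjoint supports, and u is positive on most of τ.
    have huv0 : ∀ i, u i * v i = 0 := by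
      have h1 : ∑ i, u i * v i = 0 := by
        rw [← huv]
        simp only [PiLp.inner_apply, RCLike.inner_apply, conj_trivial]
        exact Finset.sum_congr rfl fun i _ => mul_comm _ _
      intro i
      exact (Finset.sum_eq_zero_iff_of_nonneg fun i _ => mul_nonneg (hu0 i) (hv0 i)).1 h1 i
        (Finset.mem_univ i)
    have hcardu : ((Finset.univ.filter fun i => c i = τ ∧ u i * communityCoeff c τ u ≤ 0).card : ℝ) ≤
        ε * (n / 2) :=
      card_wrong_sign_le hn τ (y := 4 / 5) (by norm_num) (by nlinarith only [hs]) hru (by linarith)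
    refine signsRecover_of_card τ (α := 0) (α' := 1) (by decide) ?_ hpos2
    refine le_trans ?_ (hcardu.trans (le_of_eq (by ring)))
    gcongr with i
    intro h
    have h0 : v i ≠ 0 := fun h0 => h (by rw [h0, sign_zero])
    have h1 : u i = 0 := (mul_eq_zero.1 (huv0 i)).resolve_right h0
    rw [h1, zero_mul]

theorem sign_ne_imp_mul_nonpos {x y : ℝ} (h : SignType.sign x ≠ SignType.sign y) :
    x * y ≤ 0 := by
  by_contra h0
  rcases pos_and_pos_or_neg_and_neg_of_mul_pos (not_le.1 h0) with ⟨h1, h2⟩ | ⟨h1, h2⟩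
  · exact h (by rw [sign_pos h1, sign_pos h2])
  · exact h (by rw [sign_neg h1, sign_neg h2])

/-- The second eigenvector of a nonnegative symmetric operator that is close to the block matrix
determines the communities. -/
theorem IsNearBlock.signsRecover (hc : IsBalanced c) (hn : 0 < n) {a b β ε lam lam₁ : ℝ}
    (hε : 0 < ε) (hε1 : ε ≤ 1) (hb : 0 ≤ b) (hba : b < a) (hβ0 : 0 ≤ β)
    (hβ : β ≤ ε / 200 * (a - b))
    {T : EuclideanSpace ℝ (Fin n) →L[ℝ] EuclideanSpace ℝ (Fin n)} (hT : IsNearBlock c a b β T)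
    {u v : EuclideanSpace ℝ (Fin n)} (hu : ‖u‖ = 1) (hv : ‖v‖ = 1) (hTv : T v = lam • v)
    (hTu : T u = lam₁ • u) (hu0 : ∀ i, 0 ≤ u i) (huv : inner ℝ u v = (0 : ℝ))
    (hlam : (a - b) / 2 - β ≤ lam) (hlam₁ : lam ≤ lam₁) :
    SignsRecover c v (ε * n) := by
  have hab : 0 < a - b := sub_pos.2 hba
  have hβ1 : β ≤ 1 / 200 * (a - b) := hβ.trans (by gcongr)
  have hlam2 : 99 / 200 * (a - b) ≤ lam := by linarith
  have hr : ∀ (κ : ℝ) (x : EuclideanSpace ℝ (Fin n)), lam ≤ κ → ‖x‖ = 1 → T x = κ • x →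
      ‖communityResidual c x‖ ≤ ε / 90 := by
    intro κ x hκ hx hTx
    have h1 := hT.norm_residual_le hc hn hx hTx
    have h2 : 99 / 200 * (a - b) * ‖communityResidual c x‖ ≤ ε / 200 * (a - b) :=
      (mul_le_mul_of_nonneg_right (hlam2.trans hκ) (norm_nonneg _)).trans (h1.trans hβ)
    have h3 : 99 / 200 * ‖communityResidual c x‖ ≤ ε / 200 := by
      refine le_of_mul_le_mul_right ?_ hab
      linarith
    linarith
  have hru := hr lam₁ u hlam₁ hu hTu
  have hrv := hr lam v le_rfl hv hTv
  by_cases hsmall : ∃ τ, |communityCoeff c τ v| < 1 / 4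
  · obtain ⟨τ, hτ⟩ := hsmall
    rcases le_total 0 (communityCoeff c (!τ) v) with h | h
    · exact signsRecover_of_small_coeff hc hn hε hε1 hb hba hβ0 hβ hT hu hv hTv hTu hu0 huv hlam
        hru hrv τ hτ h
    · refine SignsRecover.of_neg ?_
      refine signsRecover_of_small_coeff (v := -v) hc hn hε hε1 hb hba hβ0 hβ hT hu
        (by rwa [norm_neg]) (by rw [map_neg, hTv, smul_neg]) hTu hu0
        (by rw [inner_neg_right, huv, neg_zero]) hlam hru ?_ τ
        (by rwa [communityCoeff_neg, abs_neg]) (by rw [communityCoeff_neg]; linarith)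
      exact hr lam (-v) le_rfl (by rwa [norm_neg]) (by rw [map_neg, hTv, smul_neg])
  · simp only [not_exists, not_lt] at hsmall
    have hsq : ∀ τ, 1 / 16 ≤ communityCoeff c τ v ^ 2 := by
      intro τ
      rw [← sq_abs]
      nlinarith [hsmall τ]
    have hne : ∀ τ, communityCoeff c τ v ≠ 0 := by
      intro τ h
      have := hsq τ
      rw [h] at this
      norm_num at this
    have hε2 : (ε / 90) ^ 2 ≤ ε / 8100 := by nlinarith
    have hcard : ∀ τ, ((Finset.univ.filter fun i => c i = τ ∧
        SignType.sign (v i) ≠ SignType.sign (communityCoeff c τ v)).card : ℝ) ≤ ε / 2 * n := by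
      intro τ
      have h1 := card_wrong_sign_le (θ := ε) hn τ (by norm_num) (hsq τ) hrv (by linarith)
      refine le_trans ?_ (h1.trans (le_of_eq (by ring)))
      gcongr with i
      exact sign_ne_imp_mul_nonpos
    refine signsRecover_of_card true ?_ (hcard true) (hcard (!true))
    -- Equal signs contradict orthogonality: u has nonnegative coefficients of sum at least 9/10 and
    -- those of v are at least 1/4 in absolute value, so their products sum to at least 9/40 in
    -- absolute value, while the residuals can compensate only 1/8100.
    intro hsign
    rw [Bool.not_true] at hsign
    have hinner := hc.inner_residual hn u v
    rw [huv] at hinner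
    have hres : |inner ℝ (communityResidual c u) (communityResidual c v)| ≤ ε / 90 * (ε / 90) :=
      (abs_real_inner_le_norm _ _).trans (mul_le_mul hru hrv (norm_nonneg _) (by positivity))
    obtain ⟨hres1, hres2⟩ := abs_le.1 hres
    have hnu := hc.norm_sq_eq hn u
    rw [hu] at hnu
    have hru2 : ‖communityResidual c u‖ ^ 2 ≤ (ε / 90) ^ 2 := by gcongr
    have hs0 : 0 ≤ communityCoeff c true u := communityCoeff_nonneg hu0
    have ht0 : 0 ≤ communityCoeff c false u := communityCoeff_nonneg hu0
    have hst : 9 / 10 ≤ communityCoeff c true u + communityCoeff c false u := by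
      nlinarith [mul_nonneg hs0 ht0]
    have h1 := hsmall true
    have h2 := hsmall false
    rcases (hne true).lt_or_gt with h | h
    · have h' : communityCoeff c false v < 0 := by
        rw [sign_neg h] at hsign
        exact sign_eq_neg_one_iff.1 hsign.symm
      rw [abs_of_neg h] at h1
      rw [abs_of_neg h'] at h2
      nlinarith
    · have h' : 0 < communityCoeff c false v := by
        rw [sign_pos h] at hsign
        exact sign_eq_one_iff.1 hsign.symm
      rw [abs_of_pos h] at h1
      rw [abs_of_pos h'] at h2
      nlinarith

end

/-! ### Eigenvalues of a matrix close to the block matrix. -/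

section

variable {n : ℕ} {c : Fin n → Bool}

theorem SignsRecover.of_smul {v : Fin n → ℝ} {m k : ℝ} (hk : 0 < k)
    (h : SignsRecover c (k • v) m) : SignsRecover c v m := by
  obtain ⟨α, β, hαβ, hle⟩ := h
  refine ⟨α, β, hαβ, ?_⟩
  simpa only [Pi.smul_apply, smul_eq_mul, sign_mul, sign_pos hk, one_mul] using hle

theorem SignsRecover.mono {v : Fin n → ℝ} {m m' : ℝ} (hm : m ≤ m')
    (h : SignsRecover c v m) : SignsRecover c v m' := by
  obtain ⟨α, β, hαβ, hle⟩ := h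
  exact ⟨α, β, hαβ, hle.trans hm⟩

theorem isNearBlock_of_norm_le (hn : 0 < n) {a b β : ℝ} {A : Matrix (Fin n) (Fin n) ℝ}
    (hs : A.IsSymm) (h0 : ∀ i j, 0 ≤ A i j)
    (hβ : ‖Matrix.toEuclideanCLM (𝕜 := ℝ) (A - blockMatrix c (a / n) (b / n))‖ ≤ β) :
    IsNearBlock c a b β (Matrix.toEuclideanCLM (𝕜 := ℝ) A) where
  symm x y := by
    rw [Matrix.inner_toEuclideanCLM, Matrix.inner_toEuclideanCLM, Matrix.dotProduct_mulVec,
      ← Matrix.mulVec_transpose, hs.eq, dotProduct_comm]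
  nonneg x y hx hy := by
    rw [Matrix.inner_toEuclideanCLM]
    refine Finset.sum_nonneg fun i _ => mul_nonneg (hx i) ?_
    rw [Matrix.mulVec, dotProduct]
    exact Finset.sum_nonneg fun j _ => mul_nonneg (h0 i j) (hy j)
  abs_sub_le x y := by
    rw [← inner_blockMatrix hn, ← inner_sub_right, ← sub_apply, ← map_sub]
    refine (abs_real_inner_le_norm _ _).trans ?_
    calc _ ≤ ‖x‖ * (β * ‖y‖) := by
          gcongr
          exact (ContinuousLinearMap.le_opNorm _ _).trans (by gcongr)
      _ = _ := by ring

/-- The quadratic form of a symmetric operator in an orthonormal basis of eigenvectors. -/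
theorem inner_apply_eq_sum {ι : Type*} [Fintype ι] {E : Type*} [NormedAddCommGroup E]
    [InnerProductSpace ℝ E] (e : OrthonormalBasis ι ℝ E) (T : E →L[ℝ] E) {κ : ι → ℝ}
    (he : ∀ i, T (e i) = κ i • e i) (x : E) :
    inner ℝ x (T x) = ∑ i, κ i * inner ℝ (e i) x ^ 2 := by
  have h : T x = ∑ i, inner ℝ (e i) x • (κ i • e i) := by
    conv_lhs => rw [← e.sum_repr' x]
    simp only [map_sum, map_smul, he]
  rw [h, inner_sum]
  refine Finset.sum_congr rfl fun i _ => ?_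
  rw [inner_smul_right, inner_smul_right, real_inner_comm]
  ring

/-- Equality in the Rayleigh bound forces an eigenvector. -/
theorem apply_eq_of_rayleigh_eq {ι : Type*} [Fintype ι] {E : Type*} [NormedAddCommGroup E]
    [InnerProductSpace ℝ E] (e : OrthonormalBasis ι ℝ E) (T : E →L[ℝ] E) {κ : ι → ℝ}
    (he : ∀ i, T (e i) = κ i • e i) {lam : ℝ} (hκ : ∀ i, κ i ≤ lam) {x : E}
    (hx : lam * ‖x‖ ^ 2 ≤ inner ℝ x (T x)) : T x = lam • x := by
  rw [inner_apply_eq_sum e T he, ← e.sum_sq_inner_right, Finset.mul_sum] at hx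
  have h0 : ∑ i, (lam - κ i) * inner ℝ (e i) x ^ 2 = 0 := by
    refine le_antisymm ?_ (Finset.sum_nonneg fun i _ =>
      mul_nonneg (sub_nonneg.2 (hκ i)) (sq_nonneg _))
    simp only [sub_mul, Finset.sum_sub_distrib]
    linarith
  have h1 : ∀ i, κ i * inner ℝ (e i) x = lam * inner ℝ (e i) x := by
    intro i
    have := (Finset.sum_eq_zero_iff_of_nonneg fun i _ =>
      mul_nonneg (sub_nonneg.2 (hκ i)) (sq_nonneg _)).1 h0 i (Finset.mem_univ i)
    rcases mul_eq_zero.1 this with h | h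
    · rw [sub_eq_zero.1 h]
    · rw [pow_eq_zero_iff two_ne_zero |>.1 h, mul_zero, mul_zero]
  conv_lhs => rw [← e.sum_repr' x]
  conv_rhs => rw [← e.sum_repr' x]
  simp only [map_sum, map_smul, he, Finset.smul_sum, smul_smul]
  refine Finset.sum_congr rfl fun i _ => ?_
  rw [mul_comm, h1]

/-- A lower bound for the second eigenvalue of an operator close to the block matrix. -/
theorem IsNearBlock.le_second_eigenvalue {ι : Type*} [Fintype ι] {a b β lam : ℝ}
    {T : EuclideanSpace ℝ (Fin n) →L[ℝ] EuclideanSpace ℝ (Fin n)} (hT : IsNearBlock c a b β T)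
    (hc : IsBalanced c) (hn : 0 < n) (hb : 0 ≤ b)
    (e : OrthonormalBasis ι ℝ (EuclideanSpace ℝ (Fin n))) {κ : ι → ℝ}
    (he : ∀ i, T (e i) = κ i • e i) (k : ι) (hκ : ∀ i, i ≠ k → κ i ≤ lam) :
    (a - b) / 2 - β ≤ lam := by
  -- The two-dimensional span of the community vectors contains a nonzero vector orthogonal to the
  -- one excluded eigenvector, as in the Courant–Fischer principle.
  obtain ⟨x, y, hxy, horth⟩ : ∃ x y : ℝ, 0 < x ^ 2 + y ^ 2 ∧
      x * inner ℝ (e k) (communityVec c true) + y * inner ℝ (e k) (communityVec c false) = 0 := by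
    by_cases h : inner ℝ (e k) (communityVec c true) = (0 : ℝ)
    · exact ⟨1, 0, by norm_num, by rw [h]; ring⟩
    · refine ⟨-inner ℝ (e k) (communityVec c false), inner ℝ (e k) (communityVec c true), ?_,
        by ring⟩
      have := pow_pos (abs_pos.2 h) 2
      rw [sq_abs] at this
      positivity
  let w : EuclideanSpace ℝ (Fin n) := x • communityVec c true + y • communityVec c false
  have hself := hc.communityCoeff_self hn
  have hnot := communityCoeff_not (c := c)
  have hw1 : communityCoeff c true w = x := by
    have h1 := hself true
    have h2 := hnot true
    simp only [communityCoeff, Bool.not_true] at h1 h2 ⊢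
    simp only [w, inner_add_right, inner_smul_right, h1, h2]
    ring
  have hw2 : communityCoeff c false w = y := by
    have h1 := hself false
    have h2 := hnot false
    simp only [communityCoeff, Bool.not_false] at h1 h2 ⊢
    simp only [w, inner_add_right, inner_smul_right, h1, h2]
    ring
  have hw : ‖w‖ ^ 2 = x ^ 2 + y ^ 2 := by
    rw [hc.norm_sq_eq hn, hw1, hw2]
    have : communityResidual c w = 0 := by
      rw [communityResidual, hw1, hw2]
      simp [w]
    rw [this, norm_zero]
    ring
  have hup : inner ℝ w (T w) ≤ lam * ‖w‖ ^ 2 := by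
    rw [inner_apply_eq_sum e T he, ← e.sum_sq_inner_right, Finset.mul_sum]
    refine Finset.sum_le_sum fun i _ => ?_
    by_cases hi : i = k
    · have : inner ℝ (e i) w = (0 : ℝ) := by
        rw [hi, inner_add_right, inner_smul_right, inner_smul_right, horth]
      rw [this]
      simp
    · exact mul_le_mul_of_nonneg_right (hκ i hi) (sq_nonneg _)
  have hlow := (abs_le.1 (hT.abs_sub_le w w)).1
  rw [blockForm, hw1, hw2, ← sq ‖w‖] at hlow
  rw [hw] at hup hlow
  refine le_of_mul_le_mul_right ?_ hxy
  -- This is the excess of the block form over (a - b)/2 times the squared norm.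
  have : 0 ≤ b / 2 * (x + y) ^ 2 := by positivity
  nlinarith

theorem signsRecover_of_isSecondEigenvector (hc : IsBalanced c) (hn : 0 < n) {a b β ε : ℝ}
    (hε : 0 < ε) (hε1 : ε ≤ 1) (hb : 0 ≤ b) (hba : b < a) (hβ0 : 0 ≤ β)
    (hβ : β ≤ ε / 200 * (a - b)) {A : Matrix (Fin n) (Fin n) ℝ}
    (hs : A.IsSymm) (h0 : ∀ i j, 0 ≤ A i j)
    (hA : ‖Matrix.toEuclideanCLM (𝕜 := ℝ) (A - blockMatrix c (a / n) (b / n))‖ ≤ β)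
    {v : Fin n → ℝ} (hv : IsSecondEigenvector A v) : SignsRecover c v (ε * n) := by
  obtain ⟨hM, k₁, k₂, hk₁, hk₂, hv0, hAv, hdeg⟩ := hv
  have hT := isNearBlock_of_norm_le (c := c) hn hs h0 hA
  set T := Matrix.toEuclideanCLM (𝕜 := ℝ) A with hTdef
  let e := (Matrix.isSymmetric_toEuclideanLin_iff.mpr hM).eigenvectorBasis
    (finrank_euclideanSpace (𝕜 := ℝ) (ι := Fin n))
  have he : ∀ i, T (e i) = hM.eigenvalues₀ i • e i := fun i =>
    (Matrix.isSymmetric_toEuclideanLin_iff.mpr hM).apply_eigenvectorBasis _ i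
  have hanti := hM.eigenvalues₀_antitone
  have hle₁ : ∀ i, hM.eigenvalues₀ i ≤ hM.eigenvalues₀ k₁ := fun i =>
    hanti (Fin.le_def.2 (by omega))
  have hle₂ : ∀ i, i ≠ k₁ → hM.eigenvalues₀ i ≤ hM.eigenvalues₀ k₂ := fun i hi =>
    hanti (Fin.le_def.2 (by
      have : (i : ℕ) ≠ k₁ := fun h => hi (Fin.ext h)
      omega))
  set lam₁ := hM.eigenvalues₀ k₁
  set lam := hM.eigenvalues₀ k₂
  have hlam : (a - b) / 2 - β ≤ lam := hT.le_second_eigenvalue hc hn hb e he k₁ hle₂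
  let v' : EuclideanSpace ℝ (Fin n) := WithLp.toLp 2 v
  have hv'0 : v' ≠ 0 := fun h => hv0 (by
    have := congrArg WithLp.ofLp h
    exact this)
  have hTv : T v' = lam • v' := by
    rw [hTdef, Matrix.toEuclideanCLM_toLp, hAv]
    rfl
  obtain ⟨u, hu0, hupos, hTu, huv⟩ : ∃ u : EuclideanSpace ℝ (Fin n), u ≠ 0 ∧ (∀ i, 0 ≤ u i) ∧
      T u = lam₁ • u ∧ inner ℝ u v' = (0 : ℝ) := by
    by_cases hlamEq : lam₁ = lam
    · obtain ⟨u, hu0, hupos, hAu, huv⟩ := hdeg hlamEq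
      refine ⟨WithLp.toLp 2 u, fun h => hu0 (congrArg WithLp.ofLp h), hupos, ?_, ?_⟩
      · rw [hTdef, Matrix.toEuclideanCLM_toLp, hAu]
        rfl
      · rw [← huv]
        simp only [v', PiLp.inner_apply, RCLike.inner_apply, conj_trivial, dotProduct]
        exact Finset.sum_congr rfl fun i _ => mul_comm _ _
    -- Perron's argument: entrywise absolute values do not lower the Rayleigh quotient of a
    -- nonnegative matrix, so they turn a leading eigenvector into a nonnegative one. Distinct
    -- eigenvalues then give orthogonality to v.
    · let u : EuclideanSpace ℝ (Fin n) := WithLp.toLp 2 fun i => |e k₁ i|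
      have hun : ‖u‖ ^ 2 = 1 := by
        have h1 : ‖e k₁‖ ^ 2 = 1 := by rw [e.norm_eq_one, one_pow]
        rw [EuclideanSpace.real_norm_sq_eq] at h1 ⊢
        simpa [u] using h1
      have hTu : T u = lam₁ • u := by
        refine apply_eq_of_rayleigh_eq e T he hle₁ ?_
        have h1 : lam₁ = inner ℝ (e k₁) (T (e k₁)) := by
          rw [he, inner_smul_right, real_inner_self_eq_norm_sq, e.norm_eq_one]
          ring
        rw [hun, mul_one, h1, hTdef, Matrix.inner_toEuclideanCLM, Matrix.inner_toEuclideanCLM]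
        simp only [dotProduct, Matrix.mulVec, Finset.mul_sum]
        refine Finset.sum_le_sum fun i _ => Finset.sum_le_sum fun j _ => ?_
        have h2 : e k₁ i * e k₁ j ≤ |e k₁ i| * |e k₁ j| := by
          rw [← abs_mul]; exact le_abs_self _
        have h3 := mul_le_mul_of_nonneg_left h2 (h0 i j)
        simp only [u]
        linarith
      refine ⟨u, fun h => ?_, fun i => abs_nonneg _, hTu, ?_⟩
      · rw [h, norm_zero] at hun
        norm_num at hun
      · have h1 := hT.symm u v'
        rw [hTv, hTu, inner_smul_right, inner_smul_right, real_inner_comm u v'] at h1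
        have h2 : (lam₁ - lam) * inner ℝ u v' = 0 := by
          linarith
        exact (mul_eq_zero.1 h2).resolve_left (sub_ne_zero.2 hlamEq)
  have hvn : 0 < ‖v'‖⁻¹ := inv_pos.2 (norm_pos_iff.2 hv'0)
  have hunit : ∀ x : EuclideanSpace ℝ (Fin n), x ≠ 0 → ‖‖x‖⁻¹ • x‖ = 1 := fun x hx => by
    rw [norm_smul, norm_inv, norm_norm, inv_mul_cancel₀ (norm_ne_zero_iff.2 hx)]
  have hmain := IsNearBlock.signsRecover (u := ‖u‖⁻¹ • u) (v := ‖v'‖⁻¹ • v') (lam := lam)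
    (lam₁ := lam₁) hc hn hε hε1 hb hba hβ0 hβ hT (hunit u hu0) (hunit v' hv'0)
    (by rw [map_smul, hTv, smul_comm]) (by rw [map_smul, hTu, smul_comm])
    (fun i => mul_nonneg (inv_nonneg.2 (norm_nonneg _)) (hupos i))
    (by rw [inner_smul_left, inner_smul_right, huv, mul_zero, mul_zero]) hlam (hle₁ k₂)
  exact SignsRecover.of_smul hvn hmain

end

/-! ### Choice of constants and conclusion. -/

theorem mainTheorem3 :
    ∀ (ε r : ℝ), 0 < ε → 1 ≤ r →
      ∃ C : ℝ, 0 < C ∧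
        ∀ (n : ℕ) (a b : ℝ) (c : Fin n → Bool), IsBalanced c →
          0 ≤ b → b < a → a ≤ n → (a - b) ^ 2 > C * (a + b) →
          ∀ (Ω : Type*) [MeasurableSpace Ω] (μ : Measure Ω) [IsProbabilityMeasure μ]
            (G : Ω → SimpleGraph (Fin n)),
            IsPlantedPartitionGraph μ c (a / n) (b / n) G →
            μ {ω | ∀ A' : Matrix (Fin n) (Fin n) ℝ,
                IsDegreeRegularization (adjacency (G ω)) (2 * a) A' →
                ∀ v : Fin n → ℝ, IsSecondEigenvector A' v → SignsRecover c v (ε * n)}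
              ≥ ENNReal.ofReal (1 - Real.exp (-r)) := by
  intro ε r hε hr
  set ε' := min ε 1 with hε'
  have hε'0 : 0 < ε' := lt_min hε one_pos
  -- The failure probabilities add up to 6e^(-ρ), and 6 ≤ e².
  set ρ := r + 2 with hρdef
  have hρ : 0 ≤ ρ := by linarith
  set D := deviationConstant ρ with hD
  have hD0 : 0 < D := by
    rw [hD, deviationConstant]
    positivity
  -- The square term gives 25D√a/ε' ≤ a - b, which is exactly D√a/8 ≤ ε'(a - b)/200; the summand 1
  -- forces a² > a, hence a ≥ 1.
  refine ⟨(25 * D / ε') ^ 2 + 1, by positivity, ?_⟩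
  intro n a b c hc hb hba han hgap Ω _ μ _ G hG
  have ha0 : 0 < a := hb.trans_lt hba
  have hn0 : (0 : ℝ) < n := ha0.trans_le han
  have hn : 0 < n := by exact_mod_cast hn0
  have hC0 : 0 ≤ (25 * D / ε') ^ 2 := sq_nonneg _
  have hgap1 : (25 * D / ε') ^ 2 * a + a < (a - b) ^ 2 := by
    have : 0 ≤ ((25 * D / ε') ^ 2 + 1) * b := by positivity
    linarith
  have ha1 : 1 ≤ a := by
    have h1 : (a - b) ^ 2 ≤ a ^ 2 := by
      refine pow_le_pow_left₀ (by linarith) (by linarith) 2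
    have h2 : a * 1 < a * a := by
      have : 0 ≤ (25 * D / ε') ^ 2 * a := by positivity
      nlinarith
    exact (lt_of_mul_lt_mul_left h2 ha0.le).le
  have hsa1 : 1 ≤ √a := Real.one_le_sqrt.2 ha1
  have hβ : D * √a / 8 ≤ ε' / 200 * (a - b) := by
    have h1 : 25 * D / ε' * √a ≤ a - b := by
      refine (pow_le_pow_iff_left₀ (by positivity) (by linarith) two_ne_zero).1 ?_
      rw [mul_pow, Real.sq_sqrt ha0.le]
      linarith
    have h2 : ε' / 200 * (25 * D / ε' * √a) = D * √a / 8 := by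
      field_simp
      norm_num
    rw [← h2]
    gcongr
  obtain ⟨L, hL1, hL2⟩ := exists_nat_pow_near hsa1 (by norm_num : (1 : ℝ) < 2)
  set P := edgeProbability c (a / n) (b / n)
  set good := {ω | ∀ A' : Matrix (Fin n) (Fin n) ℝ,
    IsDegreeRegularization (adjacency (G ω)) (2 * a) A' →
      ∀ v : Fin n → ℝ, IsSecondEigenvector A' v → SignsRecover c v (ε * n)}
  let bad₁ := {ω | ¬ HasLightBound (adjacency (G ω)) P a ρ}
  let bad₂ := {ω | ¬ HasDiscrepancy (adjacency (G ω)) a ρ L}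
  let bad₃ := {ω | ¬ HasDegreeTail (adjacency (G ω)) a ρ}
  -- A cover of the whole space and subadditivity bound the measure of `good` from below without its
  -- measurability.
  have hcover : Set.univ ⊆ good ∪ ((bad₁ ∪ bad₂) ∪ bad₃) := by
    intro ω _
    by_cases h1 : HasLightBound (adjacency (G ω)) P a ρ
    swap
    · exact Or.inr (Or.inl (Or.inl h1))
    by_cases h2 : HasDiscrepancy (adjacency (G ω)) a ρ L
    swap
    · exact Or.inr (Or.inl (Or.inr h2))
    by_cases h3 : HasDegreeTail (adjacency (G ω)) a ρ
    swap
    · exact Or.inr (Or.inr h3)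
    refine Or.inl fun A' hA' v hv => ?_
    have hBsymm : (A' - blockMatrix c (a / n) (b / n)).IsSymm := by
      refine hA'.symm.sub ?_
      ext i j
      simp only [Matrix.transpose_apply, blockMatrix, eq_comm]
    have hnorm := norm_toEuclideanCLM_le_of_int (κ := D * √a) hn hBsymm fun z hz => by
      have := abs_quadratic_form_le (c := c) hn hb hba.le ha1 han hρ hL1 hL2.le
        (adjacency_nonneg (G ω)) (adjacency_symm (G ω)) h1 h2 h3 hA' hz
      refine this.trans (le_of_eq ?_)
      ring
    exact (signsRecover_of_isSecondEigenvector hc hn hε'0 (min_le_right _ _) hb hba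
      (by positivity) hβ hA'.symm hA'.nonneg hnorm hv).mono
      (mul_le_mul_of_nonneg_right (min_le_left _ _) hn0.le)
  have hexp : Real.exp (-ρ) + 4 * Real.exp (-ρ) + Real.exp (-ρ) ≤ Real.exp (-r) := by
    have h1 : Real.exp (-r) = Real.exp 2 * Real.exp (-ρ) := by
      rw [← Real.exp_add, hρdef]
      congr 1
      ring
    have h2 : 6 ≤ Real.exp 2 := by
      have h3 : Real.exp 2 = Real.exp 1 ^ 2 := by rw [← Real.exp_nat_mul]; norm_num
      rw [h3]
      nlinarith [Real.exp_one_gt_d9]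
    rw [h1]
    nlinarith [Real.exp_pos (-ρ)]
  have hbad : μ ((bad₁ ∪ bad₂) ∪ bad₃) ≤ ENNReal.ofReal (Real.exp (-r)) := by
    refine (measure_union_le _ _).trans ((add_le_add (measure_union_le _ _) le_rfl).trans ?_)
    refine (add_le_add (add_le_add
      (hG.measure_not_hasLightBound_le hb hba.le ha1 hn hρ)
      (hG.measure_not_hasDiscrepancy_le hb hba.le hρ L))
      (hG.measure_not_hasDegreeTail_le hb hba.le hn ρ)).trans ?_
    rw [← ENNReal.ofReal_add (by positivity) (by positivity),
      ← ENNReal.ofReal_add (by positivity) (by positivity)]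
    exact ENNReal.ofReal_le_ofReal hexp
  rw [ge_iff_le, ENNReal.ofReal_sub _ (Real.exp_pos _).le, ENNReal.ofReal_one, tsub_le_iff_right]
  calc (1 : ENNReal) = μ Set.univ := measure_univ.symm
    _ ≤ μ good + μ ((bad₁ ∪ bad₂) ∪ bad₃) := (measure_mono hcover).trans (measure_union_le _ _)
    _ ≤ _ := by gcongr
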